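/- **Proposition 2 (Laplace transform of the interference, LOS association).** *Network.* Let $\mathcal W$ be a finite set of tiers. A user sits at the origin of $\mathbb R^2$. For each tier $j$, the LOS and the NLOS base stations (BSs) form Poisson point processes with densities $\lambda_j\,p_j(\|u\|)$ and $\lambda_j\,(1-p_j(\|u\|))$, where $\lambda_j\ge 0$ and $p_j:[0,\infty)\to[0,1]$ is the (measurable) LOS probability function; all these processes are independent. A LOS (NLOS) link of length $r$ to a BS of tier $j$ has path gain $C_{\mathrm L_j}r^{-\alpha_{\mathrm L_j}}$ (respectively $C_{\mathrm N_j}r^{-\alpha_{\mathrm N_j}}$), with $C_{\mathrm L_j},C_{\mathrm N_j},\alpha_{\mathrm L_j},\alpha_{\mathrm N_j}>0$. The $l$-th BS of tier $j$ carries a directivity gain $G_{jl}$ and a fading power $g_{jl}$; these marks are mutually independent and independent of the point processes. The variable $g_{jl}$ has the Gamma law $\Gamma(K_j,1)$ with integer shape $K_j\ge1$ (the number of users served by the BS, among which its power is divided evenly) and scale $1$. The variable $G_{jl}$ takes the value $a_{jk}$ with probability $b_{jk}$, $k=1,\dots,4$, where, with main lobe gains $M_{j\mathrm r},M_{j\mathrm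 t}>0$, back lobe gains $m_{j\mathrm r},m_{j\mathrm t}\ge0$, beamwidths $\theta_{j\mathrm r},\theta_{j\mathrm t}\in[0,2\pi]$, $c_{j\mathrm r}=\theta_{j\mathrm r}/2\pi$ and $c_{j\mathrm t}=\theta_{j\mathrm t}/2\pi$, $$(a_{jk})_k=(M_{j\mathrm r}M_{j\mathrm t},\ M_{j\mathrm r}m_{j\mathrm t},\ m_{j\mathrm r}M_{j\mathrm t},\ m_{j\mathrm r}m_{j\mathrm t}),$$ $$(b_{jk})_k=(c_{j\mathrm r}c_{j\mathrm t},\ c_{j\mathrm r}(1-c_{j\mathrm t}),\ (1-c_{j\mathrm r})c_{j\mathrm t},\ (1-c_{j\mathrm r})(1-c_{j\mathrm t})).$$ The user is associated with the BS, among all tiers and link states, that has the largest path gain. *Interference.* Let $w\in\mathcal W$, and consider the event that the user is associated with a LOS BS of tier $w$; let $x$ be the distance to that BS. For a reference distance $y>0$, in units of which distances are measured, let $$I_{\mathrm L}=\sum_{j\in\mathcal W}\ \sum_{l} G_{jl}\,C_{jl}\Big(\frac{R_{jl}}{y}\Big)^{-\alpha_{jl}}\frac{g_{jl}}{K_j}\in[0,\infty],$$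 the sum being over all BSs other than the serving one, at distances $R_{jl}$, where $(C_{jl},\alpha_{jl})$ is $(C_{\mathrm L_j},\alpha_{\mathrm L_j})$ or $(C_{\mathrm N_j},\alpha_{\mathrm N_j})$ according as the link is LOS or NLOS. ($y=1$ gives the unnormalized interference power.) *Claim.* Let $s\ge0$ and $y>0$; both may be measurable functions of $x$. Given that the user is associated with a LOS BS of tier $w$ at distance $x$, the conditional Laplace transform of $I_{\mathrm L}$ at $s/(M_{w\mathrm r}M_{w\mathrm t})$ is, for almost every $x$ with respect to the conditional law of the serving distance, $$\mathbb E\Big[e^{-\frac{s}{M_{w\mathrm r}M_{w\mathrm t}}I_{\mathrm L}}\,\Big|\,x\Big]=\prod_{j\in\mathcal W}\prod_{k=1}^4\exp\big(-2\pi\lambda_j b_{jk}\,(V_{jk}(x)+W_{jk}(x))\big),$$ where, with $\bar f_{jk}=\dfrac{a_{jk}}{M_{w\mathrm r}M_{w\mathrm t}}$, $$V_{jk}(x)=\int_{x_j}^\infty\Big(1-\Big(1+\frac{\bar f_{jk}C_{\mathrm L_j}s}{K_j}\Big(\frac ty\Big)^{-\alpha_{\mathrm L_j}}\Big)^{-K_j}\Big)\,p_j(t)\,t\,dt,$$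 $$W_{jk}(x)=\int_{\psi_j(x_j)}^\infty\Big(1-\Big(1+\frac{\bar f_{jk}C_{\mathrm N_j}s}{K_j}\Big(\frac ty\Big)^{-\alpha_{\mathrm N_j}}\Big)^{-K_j}\Big)\,(1-p_j(t))\,t\,dt,$$ $$x_j=\Big(\frac{C_{\mathrm L_j}}{C_{\mathrm L_w}}\Big)^{1/\alpha_{\mathrm L_j}}x^{\alpha_{\mathrm L_w}/\alpha_{\mathrm L_j}},\qquad \psi_j(r)=\Big(\frac{C_{\mathrm N_j}}{C_{\mathrm L_j}}\Big)^{1/\alpha_{\mathrm N_j}}r^{\alpha_{\mathrm L_j}/\alpha_{\mathrm N_j}}$$ (so $x_w=x$). The integrals take values in $[0,\infty]$, with $e^{-\infty}=0$ and $0\cdot\infty=0$. -/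

import Mathlib

open MeasureTheory ProbabilityTheory Set
open scoped NNReal ENNReal

noncomputable section

namespace MmWave

/-- The plane, with its Euclidean norm and Lebesgue measure. -/
abbrev Plane : Type := EuclideanSpace ℝ (Fin 2)

/-- `e^{-a}` for `a ∈ [0, ∞]`, with `e^{-∞} = 0`. -/
def expNeg (a : ℝ≥0∞) : ℝ := if a = ∞ then 0 else Real.exp (-a.toReal)

/-! ### Poisson point processes -/

section PointProcess

variable {Ω E : Type*} [MeasurableSpace Ω] [MeasurableSpace E]

/-- A point process is given by its random number of points `N ω ∈ {0, 1, …, ∞}` and an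
enumeration `X 0 ω, X 1 ω, …` of them; only the `X l ω` with `l < N ω` are points of the process.
`count N X B ω` is the number of points in `B`. -/
def count (N : Ω → ℕ∞) (X : ℕ → Ω → E) (B : Set E) (ω : Ω) : ℕ∞ :=
  {l : ℕ | (l : ℕ∞) < N ω ∧ X l ω ∈ B}.encard

/-- The points enumerated by `N` and `X` form a Poisson point process with intensity measure `Λ`:
the number of points in a set of finite intensity is Poisson distributed, and the numbers of
points in disjoint sets are independent. -/
structure IsPoissonProcess (μ : Measure Ω) (Λ : Measure E) (N : Ω → ℕ∞) (X : ℕ → Ω → E) :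
    Prop where
  measurable_number : Measurable N
  measurable_point : ∀ l, Measurable (X l)
  law_count : ∀ B : Set E, MeasurableSet B → Λ B ≠ ∞ →
    μ.map (count N X B) = (poissonMeasure (Λ B).toNNReal).map (fun n : ℕ => (n : ℕ∞))
  indep_count : ∀ (n : ℕ) (B : Fin n → Set E), (∀ i, MeasurableSet (B i)) →
    Pairwise (fun i i' => Disjoint (B i) (B i')) → iIndepFun (fun i => count N X (B i)) μ

end PointProcess

/-! ### Deterministic parameters of the network -/

/-- State of a link between a base station and the typical user. -/
inductive Sight : Type
  | los
  | nlos

/-- Parameters of a network with set of tiers `W`. -/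
structure Network (W : Type*) where
  /-- density of the outdoor base stations of a tier -/
  lam : W → ℝ
  lam_nonneg : ∀ j, 0 ≤ lam j
  /-- probability that a link of the given length is LOS -/
  p : W → ℝ → ℝ
  p_measurable : ∀ j, Measurable (p j)
  p_nonneg : ∀ j t, 0 ≤ p j t
  p_le_one : ∀ j t, p j t ≤ 1
  /-- path-loss intercepts of LOS and NLOS links -/
  C : W → Sight → ℝ
  C_pos : ∀ j z, 0 < C j z
  /-- path-loss exponents of LOS and NLOS links -/
  α : W → Sight → ℝ
  α_pos : ∀ j z, 0 < α j z
  /-- number of users served by each base station of a tier -/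
  K : W → ℕ
  K_pos : ∀ j, 0 < K j
  /-- main lobe gains at the receiver and at the transmitter -/
  Mr : W → ℝ
  Mt : W → ℝ
  Mr_pos : ∀ j, 0 < Mr j
  Mt_pos : ∀ j, 0 < Mt j
  /-- back lobe gains at the receiver and at the transmitter -/
  mr : W → ℝ
  mt : W → ℝ
  mr_nonneg : ∀ j, 0 ≤ mr j
  mt_nonneg : ∀ j, 0 ≤ mt j
  /-- main lobe beamwidths at the receiver and at the transmitter -/
  θr : W → ℝ
  θt : W → ℝ
  θr_mem : ∀ j, θr j ∈ Icc 0 (2 * Real.pi)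
  θt_mem : ∀ j, θt j ∈ Icc 0 (2 * Real.pi)

namespace Network

variable {W : Type*} (net : Network W)

def cr (j : W) : ℝ := net.θr j / (2 * Real.pi)

def ct (j : W) : ℝ := net.θt j / (2 * Real.pi)

/-- The four possible values of the directivity gain of an interfering link. -/
def a (j : W) : Fin 4 → ℝ :=
  ![net.Mr j * net.Mt j, net.Mr j * net.mt j, net.mr j * net.Mt j, net.mr j * net.mt j]

/-- The probabilities of these four values. -/
def b (j : W) : Fin 4 → ℝ :=
  ![net.cr j * net.ct j, net.cr j * (1 - net.ct j), (1 - net.cr j) * net.ct j,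
    (1 - net.cr j) * (1 - net.ct j)]

/-- Law of the directivity gain of an interfering link of tier `j`. -/
def gainLaw (j : W) : Measure ℝ :=
  ∑ k : Fin 4, ENNReal.ofReal (net.b j k) • Measure.dirac (net.a j k)

/-- Probability that a link of length `t` to a base station of tier `j` is in the given state. -/
def linkProb (j : W) : Sight → ℝ → ℝ
  | Sight.los, t => net.p j t
  | Sight.nlos, t => 1 - net.p j t

/-- Intensity measure of the LOS (NLOS) base stations of tier `j`: density `λ_j p_j(‖u‖)`
(respectively `λ_j (1 - p_j(‖u‖))`) with respect to Lebesgue measure. -/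
def intensity (j : W) (z : Sight) : Measure Plane :=
  (volume : Measure Plane).withDensity
    (fun u => ENNReal.ofReal (net.lam j * net.linkProb j z ‖u‖))

/-- Path gain `C r^{-α}` of a link of length `r`. -/
def pathGain (j : W) (z : Sight) (r : ℝ) : ℝ := net.C j z * r ^ (-net.α j z)

end Network

/-! ### The random network -/

/-- The random elements of the network, indexed by the class `(j, z)` of a base station (tier and
link state) and by its number `l` within the class: number of base stations, positions relative to
the typical user at the origin, directivity gains, fading powers. -/
structure Field (W Ω : Type*) where
  N : W × Sight → Ω → ℕ∞
  X : W × Sight → ℕ → Ω → Plane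
  G : (W × Sight) × ℕ → Ω → ℝ
  g : (W × Sight) × ℕ → Ω → ℝ

variable {W Ω : Type*}

/-- The probabilistic model. The LOS and NLOS base stations of the various tiers form independent
Poisson processes; they carry mutually independent marks, independent of the processes: a
directivity gain, and a fading power with law `Γ(K_j, 1)`. -/
structure IsModel [MeasurableSpace Ω] (μ : Measure Ω) (net : Network W) (F : Field W Ω) :
    Prop where
  poisson : ∀ i, IsPoissonProcess μ (net.intensity i.1 i.2) (F.N i) (F.X i)
  indep_processes : iIndepFun (fun i ω => (F.N i ω, fun l => F.X i l ω)) μ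
  measurable_gain : ∀ q, Measurable (F.G q)
  law_gain : ∀ q, μ.map (F.G q) = net.gainLaw q.1.1
  measurable_fading : ∀ q, Measurable (F.g q)
  law_fading : ∀ q, μ.map (F.g q) = gammaMeasure (net.K q.1.1 : ℝ) 1
  indep_gain_fading : ∀ q, IndepFun (F.G q) (F.g q) μ
  indep_marks : iIndepFun (fun q ω => (F.G q ω, F.g q ω)) μ
  indep_processes_marks :
    IndepFun (fun ω i => (F.N i ω, fun l => F.X i l ω)) (fun ω q => (F.G q ω, F.g q ω)) μ

namespace Field

variable (net : Network W) (F : Field W Ω)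

/-- Base station `q` exists in the realization `ω`. -/
def Present (q : (W × Sight) × ℕ) (ω : Ω) : Prop := (q.2 : ℕ∞) < F.N q.1 ω

/-- Length of the link to base station `q`. -/
def dist (q : (W × Sight) × ℕ) (ω : Ω) : ℝ := ‖F.X q.1 q.2 ω‖

/-- The typical user is associated with base station `q`: its average received power (path gain)
exceeds that of all other base stations. -/
def Serves (q : (W × Sight) × ℕ) (ω : Ω) : Prop :=
  F.Present q ω ∧ ∀ q', q' ≠ q → F.Present q' ω →
    net.pathGain q'.1.1 q'.1.2 (F.dist q' ω) < net.pathGain q.1.1 q.1.2 (F.dist q ω)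

/-- The event that the typical user is associated with a LOS base station of tier `w`. -/
def servedLOS (w : W) : Set Ω := {ω | ∃ l, F.Serves net ((w, Sight.los), l) ω}

/-- The serving base station, on the event `servedLOS w`. -/
def servingBS (w : W) (ω : Ω) : (W × Sight) × ℕ :=
  ((w, Sight.los), sInf {l | F.Serves net ((w, Sight.los), l) ω})

/-- The distance to the serving base station, on the event `servedLOS w`. -/
def servingDist (w : W) (ω : Ω) : ℝ := F.dist (F.servingBS net w ω) ω

open Classical in
/-- The aggregate interference power `∑ G C (R / y)^{-α} g / K`, over all base stations of all
tiers other than the serving one, on the event `servedLOS w`. Distances are measured in units of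
`y`. Each base station divides its (unit) power evenly between its `K` users. -/
def interference (w : W) (y : ℝ) (ω : Ω) : ℝ≥0∞ :=
  ∑' q : (W × Sight) × ℕ,
    if F.Present q ω ∧ q ≠ F.servingBS net w ω then
      ENNReal.ofReal
        (F.G q ω * net.pathGain q.1.1 q.1.2 (F.dist q ω / y) * (F.g q ω / net.K q.1.1))
    else 0

end Field

/-! ### The analytic expression -/

namespace Network

variable (net : Network W)

/-- The distance at which a LOS base station of tier `j` has the same path gain as a LOS base
station of tier `w` at distance `x`. It is `x` if the two tiers have the same LOS path loss. -/
def losRadius (w j : W) (x : ℝ) : ℝ :=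
  (net.C j Sight.los / net.C w Sight.los) ^ (1 / net.α j Sight.los)
    * x ^ (net.α w Sight.los / net.α j Sight.los)

/-- The distance at which an NLOS base station of tier `j` has the same path gain as a LOS base
station of tier `j` at distance `x`. -/
def ψ (j : W) (x : ℝ) : ℝ :=
  (net.C j Sight.nlos / net.C j Sight.los) ^ (1 / net.α j Sight.nlos)
    * x ^ (net.α j Sight.los / net.α j Sight.nlos)

/-- Directivity gain of an interfering link relative to the gain of the desired link. -/
def fbar (w j : W) (k : Fin 4) : ℝ := net.a j k / (net.Mr w * net.Mt w)

/-- `1 - (1 + f̄ C s (t/y)^{-α} / K)^{-K}` -/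
def kernel (w j : W) (z : Sight) (k : Fin 4) (s y t : ℝ) : ℝ :=
  1 - 1 / (1 + net.fbar w j k * net.C j z * s / net.K j * (t / y) ^ (-net.α j z)) ^ net.K j

/-- The integral over the LOS region. -/
def V (w j : W) (k : Fin 4) (s y x : ℝ) : ℝ≥0∞ :=
  ∫⁻ t in Ioi (net.losRadius w j x),
    ENNReal.ofReal (net.kernel w j Sight.los k s y t * net.p j t * t)

/-- The integral over the NLOS region. -/
def Wint (w j : W) (k : Fin 4) (s y x : ℝ) : ℝ≥0∞ :=
  ∫⁻ t in Ioi (net.ψ j (net.losRadius w j x)),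
    ENNReal.ofReal (net.kernel w j Sight.nlos k s y t * (1 - net.p j t) * t)

/-- `∏_j ∏_k exp(-2 π λ_j b_{jk} (V_{jk}(x) + W_{jk}(x)))` -/
def laplaceFormula [Fintype W] (w : W) (s y x : ℝ) : ℝ :=
  ∏ j : W, ∏ k : Fin 4,
    expNeg (ENNReal.ofReal (2 * Real.pi * net.lam j * net.b j k)
      * (net.V w j k s y x + net.Wint w j k s y x))

end Network

end MmWave

end

open MeasureTheory ProbabilityTheory Set
open scoped NNReal ENNReal

noncomputable section

namespace MmWave

/-! ### The exponential `e^{-a}` with values in `[0, 1] ⊆ [0, ∞]` -/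

/-! Almost surely, the user is served by a LOS base station of tier `w` at distance `t` exactly when
the nearest point of the class `(w, los)` is at distance `t` and every other class `i` has no point
within `radius w i t`. Given the positions, the marks are independent, so averaging over them turns
an interferer of class `i` at distance `r` into a factor `powerLaplace i c r`, written `e^{-v_i(r)}`
with `v_i = logLaplace`. What remains concerns independent Poisson processes only.

For the classes `i ≠ (w, los)`, the void event is absorbed into the Laplace functional: putting the
weight `∞` on the forbidden disc (`kill`) makes `e^{-∑ v_i}` vanish as soon as a point falls there.
For the class `(w, los)`, the joint law of the nearest distance `R` and of `Z = e^{-∑ v}` is needed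
(`lintegral_nearest`). The same device gives the tail `E[Z; R ≥ a] = e^{-Q - κ(Iio a)}`, where `Q =
∫ (1 - e^{-v})` and `κ` is the radial intensity multiplied by `e^{-v}`. Differentiating in `a` gives
the density without Palm calculus. The extra factor `e^{-v(t)}` in `κ` belongs to the serving
station, which does not interfere, and cancels against its inverse, introduced in
`lintegral_servedLOS_weighted_eq_prod`.

Hence `lintegral_servedLOS_weighted`: the integral of `f(x) e^{-∑ c_i I_i}` over the association
event is that of `f`, times `condLaplace`, times void probabilities independent of `c`. The case `c
= 0` gives the law of the serving distance `x`, so `condLaplace` is the conditional Laplace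
transform. Coefficients depending on `x` are reached through simple functions
(`lintegral_weighted_eq`). The Gamma transform, the four-point gain law and polar coordinates
identify `condLaplace` with the formula (`condLaplace_coeff`).

Exponentials are kept in `[0, ∞]` throughout, so that infinite sums and integrals need no
summability. -/

/-- `e^{-a}` for `a ∈ [0, ∞]`, as an extended nonnegative real. -/
def eneg (a : ℝ≥0∞) : ℝ≥0∞ := EReal.exp (-(a : EReal))

lemma eneg_eq_inv (a : ℝ≥0∞) : eneg a = (EReal.exp (a : EReal))⁻¹ := EReal.exp_neg _

@[simp] lemma eneg_zero : eneg 0 = 1 := by simp [eneg]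

@[simp] lemma eneg_top : eneg ∞ = 0 := by simp [eneg]

lemma eneg_eq_zero_iff {a : ℝ≥0∞} : eneg a = 0 ↔ a = ∞ := by
  simp [eneg]

lemma eneg_add (a b : ℝ≥0∞) : eneg (a + b) = eneg a * eneg b := by
  have h (c : ℝ≥0∞) : EReal.exp (c : EReal) ≠ 0 := by
    simp [EReal.exp_eq_zero_iff]
  rw [eneg_eq_inv, eneg_eq_inv, eneg_eq_inv, EReal.coe_ennreal_add, EReal.exp_add,
    ENNReal.mul_inv (Or.inl (h a)) (Or.inr (h b))]

lemma eneg_antitone : Antitone eneg := by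
  intro a b hab
  unfold eneg
  apply EReal.exp_monotone
  rw [EReal.neg_le_neg_iff]
  exact_mod_cast hab

lemma eneg_le_one (a : ℝ≥0∞) : eneg a ≤ 1 := by
  simpa using eneg_antitone (zero_le (a := a))

lemma eneg_ne_top (a : ℝ≥0∞) : eneg a ≠ ∞ := ne_top_of_le_ne_top ENNReal.one_ne_top (eneg_le_one a)

lemma continuous_eneg : Continuous eneg :=
  ENNReal.continuous_exp.comp (continuous_neg.comp continuous_coe_ennreal_ereal)

lemma measurable_eneg : Measurable eneg := continuous_eneg.measurable

lemma eneg_ofReal {a : ℝ} (ha : 0 ≤ a) : eneg (ENNReal.ofReal a) = ENNReal.ofReal (Real.exp (-a)) := by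
  rw [eneg, EReal.coe_ennreal_ofReal, max_eq_left ha, ← EReal.coe_neg, EReal.exp_coe]

lemma eneg_coe (a : ℝ≥0) : eneg a = ENNReal.ofReal (Real.exp (-a)) := by
  rw [← eneg_ofReal a.coe_nonneg, ENNReal.ofReal_coe_nnreal]

lemma ofReal_expNeg (a : ℝ≥0∞) : ENNReal.ofReal (expNeg a) = eneg a := by
  induction a with
  | top => simp [expNeg]
  | coe a => simp [expNeg, eneg_coe]

lemma expNeg_nonneg (a : ℝ≥0∞) : 0 ≤ expNeg a := by
  unfold expNeg; split_ifs <;> positivity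

lemma expNeg_eq_toReal (a : ℝ≥0∞) : expNeg a = (eneg a).toReal := by
  rw [← ofReal_expNeg, ENNReal.toReal_ofReal (expNeg_nonneg a)]

lemma eneg_sum {ι : Type*} (s : Finset ι) (f : ι → ℝ≥0∞) :
    eneg (∑ i ∈ s, f i) = ∏ i ∈ s, eneg (f i) := by
  classical
  induction s using Finset.induction_on with
  | empty => simp
  | insert i s hi ih => rw [Finset.sum_insert hi, Finset.prod_insert hi, eneg_add, ih]

/-- The inverse of `eneg` on `[0, 1]`. -/
def nlog (a : ℝ≥0∞) : ℝ≥0∞ := (-(ENNReal.log a)).toENNReal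

lemma measurable_nlog : Measurable nlog := by
  unfold nlog
  exact ENNReal.measurable_log.neg.ereal_toENNReal

lemma eneg_nlog {a : ℝ≥0∞} (ha : a ≤ 1) : eneg (nlog a) = a := by
  have h : 0 ≤ -(ENNReal.log a) := by
    rw [EReal.le_neg, neg_zero]
    exact ENNReal.log_le_zero_iff.2 ha
  rw [eneg, nlog, EReal.coe_toENNReal h, neg_neg, ENNReal.exp_log]

/-! ### Sums over the points of a process -/

/-- The sum of `u` over the points of the configuration with number of points `p.1` and
enumeration `p.2`. -/
def psum {E : Type*} (u : E → ℝ≥0∞) (p : ℕ∞ × (ℕ → E)) : ℝ≥0∞ :=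
  ∑' l : ℕ, if (l : ℕ∞) < p.1 then u (p.2 l) else 0

lemma psum_indicator_one {Ω E : Type*} (B : Set E) (N : Ω → ℕ∞) (X : ℕ → Ω → E) (ω : Ω) :
    psum (B.indicator 1) (N ω, fun l => X l ω) = ((count N X B ω : ℕ∞) : ℝ≥0∞) := by
  rw [count, psum, ← ENNReal.tsum_set_one, tsum_subtype _ (fun _ => (1 : ℝ≥0∞))]
  congr 1 with l
  by_cases h : (l : ℕ∞) < N ω <;> by_cases h' : X l ω ∈ B <;> simp [h, h', indicator]

section Configuration

variable {Ω E : Type*} [MeasurableSpace E]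

/-- The counting measure of a configuration. -/
def pmeasure (p : ℕ∞ × (ℕ → E)) : Measure E :=
  Measure.sum fun l : ℕ => if (l : ℕ∞) < p.1 then Measure.dirac (p.2 l) else 0

lemma lintegral_pmeasure {u : E → ℝ≥0∞} (hu : Measurable u) (p : ℕ∞ × (ℕ → E)) :
    ∫⁻ z, u z ∂(pmeasure p) = psum u p := by
  rw [pmeasure, lintegral_sum_measure, psum]
  congr 1 with l
  split_ifs <;> simp [lintegral_dirac' _ hu]

lemma measurableSet_present (l : ℕ) : MeasurableSet {p : ℕ∞ × (ℕ → E) | (l : ℕ∞) < p.1} :=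
  measurable_fst (MeasurableSet.of_discrete (s := Ioi (l : ℕ∞)))

lemma measurable_psum_prod {T : Type*} [MeasurableSpace T] {u : T → E → ℝ≥0∞}
    (hu : Measurable (Function.uncurry u)) :
    Measurable fun q : T × (ℕ∞ × (ℕ → E)) => psum (u q.1) q.2 := by
  unfold psum
  refine Measurable.tsum fun l => ?_
  refine Measurable.ite (measurable_snd (measurableSet_present l)) ?_ measurable_const
  exact hu.comp (measurable_fst.prodMk
    ((measurable_pi_apply l).comp (measurable_snd.comp measurable_snd)))

lemma measurable_psum {u : E → ℝ≥0∞} (hu : Measurable u) : Measurable (psum u) :=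
  (measurable_psum_prod (T := Unit) (u := fun _ => u) (hu.comp measurable_snd)).comp
    (measurable_const.prodMk measurable_id : Measurable fun p => ((), p))

lemma pmeasure_apply {B : Set E} (hB : MeasurableSet B) (N : Ω → ℕ∞) (X : ℕ → Ω → E) (ω : Ω) :
    pmeasure (N ω, fun l => X l ω) B = ((count N X B ω : ℕ∞) : ℝ≥0∞) := by
  rw [← psum_indicator_one, ← lintegral_pmeasure (measurable_one.indicator hB),
    lintegral_indicator_one hB]

end Configuration

/-! ### The Laplace functional of a Poisson process -/

/-- The exponential weight replaces the parameter `r` by `r e^{-c}` in the exponential series. -/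
lemma lintegral_poissonMeasure_eneg (r : ℝ≥0) (c : ℝ≥0) :
    ∫⁻ n, eneg (c * (n : ℝ≥0∞)) ∂(poissonMeasure r) = eneg (r * (1 - eneg c)) := by
  rw [poissonMeasure, lintegral_sum_measure]
  have h1 (n : ℕ) : ∫⁻ a, eneg (c * (a : ℝ≥0∞))
      ∂(ENNReal.ofReal (Real.exp (-r) * r ^ n / (n.factorial)) • (Measure.dirac n : Measure ℕ))
      = ENNReal.ofReal (Real.exp (-r) * ((r * Real.exp (-c)) ^ n / n.factorial)) := by
    rw [lintegral_smul_measure, lintegral_dirac]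
    have : (c : ℝ≥0∞) * (n : ℝ≥0∞) = ((c * n : ℝ≥0) : ℝ≥0∞) := by push_cast; rfl
    rw [this, eneg_coe, smul_eq_mul, ← ENNReal.ofReal_mul (by positivity)]
    congr 1
    rw [mul_pow, ← Real.exp_nat_mul]
    push_cast
    rw [show -((c : ℝ) * n) = n * -c by ring]
    ring
  simp_rw [h1]
  have hs : HasSum (fun n : ℕ => (r * Real.exp (-c)) ^ n / n.factorial)
      (Real.exp (r * Real.exp (-c))) := by
    rw [Real.exp_eq_exp_ℝ]
    exact NormedSpace.expSeries_div_hasSum_exp _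
  rw [← ENNReal.ofReal_tsum_of_nonneg (fun n => by positivity) (hs.mul_left _).summable,
    (hs.mul_left _).tsum_eq, ← Real.exp_add]
  have h2 : (r : ℝ≥0∞) * (1 - eneg c) = ENNReal.ofReal (r * (1 - Real.exp (-c))) := by
    rw [eneg_coe, ENNReal.ofReal_mul r.coe_nonneg, ENNReal.ofReal_sub _ (by positivity)]
    simp
  rw [h2, eneg_ofReal]
  · congr 2; ring
  · have : Real.exp (-c) ≤ 1 := Real.exp_le_one_iff.2 (by simp)
    have := r.2
    apply mul_nonneg this; linarith

section Laplace

variable {Ω E : Type*} [MeasurableSpace Ω] [MeasurableSpace E]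
  {μ : Measure Ω} {Λ : Measure E} {N : Ω → ℕ∞} {X : ℕ → Ω → E}

namespace IsPoissonProcess

lemma measurable_config (h : IsPoissonProcess μ Λ N X) :
    Measurable fun ω => (N ω, fun l => X l ω) :=
  h.measurable_number.prodMk (measurable_pi_lambda _ h.measurable_point)

lemma measurable_count (h : IsPoissonProcess μ Λ N X) {B : Set E} (hB : MeasurableSet B) :
    Measurable (count N X B) := by
  have h1 : Measurable fun ω => ((count N X B ω : ℕ∞) : ℝ≥0∞) := by
    simp_rw [← psum_indicator_one]
    exact (measurable_psum (measurable_one.indicator hB)).comp h.measurable_config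
  refine measurable_to_countable' fun n => ?_
  have : count N X B ⁻¹' {n} = (fun ω => ((count N X B ω : ℕ∞) : ℝ≥0∞)) ⁻¹' {(n : ℝ≥0∞)} := by
    ext ω; simp
  rw [this]
  exact h1 (measurableSet_singleton _)

lemma lintegral_count (h : IsPoissonProcess μ Λ N X) {B : Set E} (hB : MeasurableSet B)
    (hΛ : Λ B ≠ ∞) (f : ℕ∞ → ℝ≥0∞) :
    ∫⁻ ω, f (count N X B ω) ∂μ = ∫⁻ n : ℕ, f n ∂(poissonMeasure (Λ B).toNNReal) := by
  have hf : Measurable f := fun _ _ => trivial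
  rw [← lintegral_map (g := count N X B) hf (h.measurable_count hB), h.law_count B hB hΛ,
    lintegral_map hf Measurable.of_discrete]

/-- The sum over the points is a linear combination of the counts in the fibres of `f`; these are
independent Poisson variables, so the Laplace transform factors. -/
lemma laplace_simpleFunc (h : IsPoissonProcess μ Λ N X) (f : SimpleFunc E ℝ≥0∞)
    (hf : ∀ z, f z ≠ ∞) (hfΛ : ∀ c ≠ 0, Λ (f ⁻¹' {c}) ≠ ∞) :
    ∫⁻ ω, eneg (psum f (N ω, fun l => X l ω)) ∂μ = eneg (∫⁻ z, (1 - eneg (f z)) ∂Λ) := by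
  classical
  -- The fibre over `0` may have infinite intensity, and its count no Poisson law. It is discarded
  -- here, for the counting measure and for `Λ` alike, because `g 0 = 0`.
  have key (m : Measure E) (g : ℝ≥0∞ → ℝ≥0∞) (hg : g 0 = 0) :
      ∫⁻ z, g (f z) ∂m = ∑ c ∈ f.range.filter (· ≠ 0), g c * m (f ⁻¹' {c}) := by
    have : ∫⁻ z, g (f z) ∂m = (f.map g).lintegral m := by
      rw [← SimpleFunc.lintegral_eq_lintegral]; rfl
    rw [this, SimpleFunc.map_lintegral, Finset.sum_filter_of_ne]
    intro c _ hc h0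
    simp [h0, hg] at hc
  set s := f.range.filter (· ≠ 0) with hs
  have hpt (ω : Ω) : eneg (psum f (N ω, fun l => X l ω))
      = ∏ c ∈ s, eneg (c * ((count N X (f ⁻¹' {c}) ω : ℕ∞) : ℝ≥0∞)) := by
    rw [← lintegral_pmeasure f.measurable, key _ (fun c => c) rfl, eneg_sum]
    refine Finset.prod_congr rfl fun c _ => ?_
    rw [pmeasure_apply (f.measurableSet_fiber c)]
  simp_rw [hpt]
  rw [key Λ (fun c => 1 - eneg c) (by simp), eneg_sum]
  have hind : iIndepFun (fun (i : Fin s.card) => count N X (f ⁻¹' {(s.equivFin.symm i : ℝ≥0∞)})) μ := by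
    refine h.indep_count _ _ (fun i => f.measurableSet_fiber _) fun i i' hii => ?_
    refine disjoint_left.2 fun z hz hz' => hii ?_
    have : (s.equivFin.symm i : ℝ≥0∞) = s.equivFin.symm i' := hz.symm.trans hz'
    exact s.equivFin.symm.injective (Subtype.ext this)
  have h2 := lintegral_prod_eq_prod_lintegral_of_indepFun Finset.univ
    (fun i ω => eneg ((s.equivFin.symm i : ℝ≥0∞) *
      ((count N X (f ⁻¹' {(s.equivFin.symm i : ℝ≥0∞)}) ω : ℕ∞) : ℝ≥0∞)))
    (hind.comp (fun i n => eneg ((s.equivFin.symm i : ℝ≥0∞) * ((n : ℕ∞) : ℝ≥0∞)))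
      (fun i => fun _ _ => trivial))
    (fun i => (show Measurable (fun n : ℕ∞ => eneg ((s.equivFin.symm i : ℝ≥0∞) * (n : ℝ≥0∞)))
      from fun _ _ => trivial).comp (h.measurable_count (f.measurableSet_fiber _)))
  have reidx (G : ℝ≥0∞ → ℝ≥0∞) : ∏ i : Fin s.card, G (s.equivFin.symm i) = ∏ c ∈ s, G c := by
    rw [Equiv.prod_comp s.equivFin.symm (fun c : s => G c), Finset.prod_coe_sort]
  simp_rw [fun ω => reidx (fun c => eneg (c * ((count N X (f ⁻¹' {c}) ω : ℕ∞) : ℝ≥0∞)))] at h2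
  rw [h2, reidx (fun c => ∫⁻ ω, eneg (c * ((count N X (f ⁻¹' {c}) ω : ℕ∞) : ℝ≥0∞)) ∂μ)]
  refine Finset.prod_congr rfl fun c hc => ?_
  obtain ⟨hc1, hc0⟩ := Finset.mem_filter.1 hc
  obtain ⟨z, rfl⟩ := SimpleFunc.mem_range.1 hc1
  have hfin := hfΛ _ hc0
  rw [h.lintegral_count (f.measurableSet_fiber _) hfin (fun n => eneg (f z * (n : ℝ≥0∞)))]
  have := lintegral_poissonMeasure_eneg (Λ (f ⁻¹' {f z})).toNNReal (f z).toNNReal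
  rw [ENNReal.coe_toNNReal (hf z), ENNReal.coe_toNNReal hfin, mul_comm (Λ _)] at this
  simpa using this

/-- The Laplace functional of a Poisson process. -/
lemma laplace [SigmaFinite Λ] [IsProbabilityMeasure μ] (h : IsPoissonProcess μ Λ N X)
    {u : E → ℝ≥0∞} (hu : Measurable u) :
    ∫⁻ ω, eneg (psum u (N ω, fun l => X l ω)) ∂μ = eneg (∫⁻ z, (1 - eneg (u z)) ∂Λ) := by
  classical
  -- Cutting off to a spanning set makes the fibres over nonzero values of finite intensity, as the
  -- simple case requires.
  set f : ℕ → SimpleFunc E ℝ≥0∞ := fun n =>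
    (SimpleFunc.eapprox u n).restrict (spanningSets Λ n) with hf
  have hfval (n : ℕ) (z : E) : f n z = (spanningSets Λ n).indicator (SimpleFunc.eapprox u n) z := by
    rw [hf]; simp only; rw [SimpleFunc.restrict_apply _ (measurableSet_spanningSets Λ n)]
  have hmono (z : E) : Monotone fun n => f n z := by
    intro m n hmn
    simp only [hfval]
    refine (indicator_le_indicator_of_subset (monotone_spanningSets Λ hmn)
      (fun _ => zero_le) z).trans ?_
    exact indicator_le_indicator (SimpleFunc.monotone_eapprox u hmn z)
  have hsup (z : E) : ⨆ n, f n z = u z := by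
    rw [← SimpleFunc.iSup_eapprox_apply hu z]
    apply le_antisymm
    · exact iSup_mono fun n => by rw [hfval]; exact indicator_le_self _ _ _
    · obtain ⟨m, hm⟩ : ∃ m, z ∈ spanningSets Λ m := by
        have := iUnion_spanningSets Λ
        exact mem_iUnion.1 (this ▸ mem_univ z)
      refine iSup_le fun n => le_iSup_of_le (max m n) ?_
      rw [hfval, indicator_of_mem (monotone_spanningSets Λ (le_max_left m n) hm)]
      exact SimpleFunc.monotone_eapprox u (le_max_right m n) z
  have hsimple (n : ℕ) := h.laplace_simpleFunc (f n)
    (fun z => by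
      rw [hfval]
      exact ((indicator_le_self _ _ z).trans_lt (SimpleFunc.eapprox_lt_top u n z)).ne)
    (fun c hc => by
      refine ne_top_of_le_ne_top (measure_spanningSets_lt_top Λ n).ne (measure_mono fun z hz => ?_)
      by_contra hz'
      have : f n z = c := hz
      rw [hfval, indicator_of_notMem hz'] at this
      exact hc this.symm)
  -- The outer expectation converges by domination by `1`; the sum over the points, seen as an
  -- integral against the counting measure, converges monotonically.
  have hL : Filter.Tendsto (fun n => ∫⁻ ω, eneg (psum (f n) (N ω, fun l => X l ω)) ∂μ) Filter.atTop
      (nhds (∫⁻ ω, eneg (psum u (N ω, fun l => X l ω)) ∂μ)) := by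
    refine tendsto_lintegral_of_dominated_convergence (fun _ => 1) (fun n => ?_) (fun n => ?_)
      (by simp) ?_
    · exact measurable_eneg.comp ((measurable_psum (f n).measurable).comp h.measurable_config)
    · exact Filter.Eventually.of_forall fun ω => eneg_le_one _
    · refine Filter.Eventually.of_forall fun ω => (continuous_eneg.tendsto _).comp ?_
      rw [← lintegral_pmeasure hu]
      simp_rw [fun n => (lintegral_pmeasure (f n).measurable (N ω, fun l => X l ω)).symm]
      exact lintegral_tendsto_of_tendsto_of_monotone (fun n => (f n).measurable.aemeasurable)
        (Filter.Eventually.of_forall hmono)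
        (Filter.Eventually.of_forall fun z => hsup z ▸ tendsto_atTop_iSup (hmono z))
  have hR : Filter.Tendsto (fun n => eneg (∫⁻ z, (1 - eneg (f n z)) ∂Λ)) Filter.atTop
      (nhds (eneg (∫⁻ z, (1 - eneg (u z)) ∂Λ))) := by
    refine (continuous_eneg.tendsto _).comp ?_
    refine lintegral_tendsto_of_tendsto_of_monotone
      (fun n => (measurable_const.sub (measurable_eneg.comp (f n).measurable)).aemeasurable)
      (Filter.Eventually.of_forall fun z m n hmn =>
        tsub_le_tsub_left (eneg_antitone (hmono z hmn)) 1)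
      (Filter.Eventually.of_forall fun z => ?_)
    refine ENNReal.Tendsto.sub tendsto_const_nhds ?_ (Or.inl ENNReal.one_ne_top)
    exact (continuous_eneg.tendsto _).comp (hsup z ▸ tendsto_atTop_iSup (hmono z))
  exact tendsto_nhds_unique hL (by simpa only [hsimple] using hR)

end IsPoissonProcess

end Laplace

/-! ### Measures on the half-line with locally bounded density -/

/-- Quadratic increments force a zero derivative everywhere. This stands in for the fundamental
theorem of calculus when the density is only locally bounded, and also shows that coincidences of
distances are null. -/
lemma const_of_abs_sub_le_sq {f : ℝ → ℝ}
    (hf : ∀ b, ∃ M : ℝ, ∀ s t, s ≤ t → t ≤ b → |f t - f s| ≤ M * (t - s) ^ 2) (s t : ℝ) :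
    f s = f t := by
  have hd (x : ℝ) : HasDerivAt f 0 x := by
    obtain ⟨M, hM⟩ := hf (x + 1)
    rw [hasDerivAt_iff_isLittleO]
    have h1 : (fun y => f y - f x - (y - x) • (0 : ℝ)) =O[nhds x] fun y => (y - x) ^ 2 := by
      refine Asymptotics.IsBigO.of_bound M ?_
      filter_upwards [Iio_mem_nhds (lt_add_one x)] with y hy
      simp only [smul_zero, sub_zero, norm_pow, Real.norm_eq_abs, sq_abs]
      rcases le_total x y with h | h
      · exact hM x y h hy.le
      · rw [abs_sub_comm, show (y - x) ^ 2 = (x - y) ^ 2 by ring]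
        exact hM y x h (by linarith)
    refine h1.trans_isLittleO ?_
    have h2 : (fun y : ℝ => y - x) =o[nhds x] fun _ => (1 : ℝ) := by
      rw [Asymptotics.isLittleO_one_iff]
      have : ContinuousAt (fun y : ℝ => y - x) x := by fun_prop
      simpa [ContinuousAt] using this
    simpa [sq] using (Asymptotics.isBigO_refl (fun y : ℝ => y - x) (nhds x)).mul_isLittleO h2
  exact is_const_of_deriv_eq_zero (fun x => (hd x).differentiableAt) (fun x => (hd x).deriv) s t

/-- A measure on `[0, ∞)` with locally bounded density. -/
structure IsRadial (κ : Measure ℝ) : Prop where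
  null_neg : κ (Iio 0) = 0
  lip : ∀ b, ∃ M : ℝ≥0, ∀ s t, s ≤ t → t ≤ b → κ (Ico s t) ≤ M * ENNReal.ofReal (t - s)

namespace IsRadial

variable {κ : Measure ℝ}

lemma mono {κ' : Measure ℝ} (h : IsRadial κ) (hle : κ' ≤ κ) : IsRadial κ' where
  null_neg := le_antisymm ((hle _).trans_eq h.null_neg) zero_le
  lip b := by
    obtain ⟨M, hM⟩ := h.lip b
    exact ⟨M, fun s t hst htb => (hle _).trans (hM s t hst htb)⟩

lemma measure_Iio_ne_top (h : IsRadial κ) (b : ℝ) : κ (Iio b) ≠ ∞ := by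
  obtain ⟨M, hM⟩ := h.lip (max b 0)
  have h1 : κ (Iio b) ≤ κ (Iio 0) + κ (Ico 0 (max b 0)) := by
    refine (measure_mono fun x hx => ?_).trans (measure_union_le _ _)
    rcases lt_or_ge x 0 with h0 | h0
    · exact Or.inl h0
    · exact Or.inr ⟨h0, lt_max_of_lt_left hx⟩
  refine ne_top_of_le_ne_top ?_ (h1.trans (add_le_add h.null_neg.le
    (hM 0 _ (le_max_right _ _) le_rfl)))
  simp [ENNReal.mul_eq_top]

lemma withDensity (h : IsRadial κ) {m : ℝ → ℝ≥0∞} (hm : ∀ t, m t ≤ 1) :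
    IsRadial (κ.withDensity m) := by
  refine h.mono ?_
  calc κ.withDensity m ≤ κ.withDensity 1 := withDensity_mono (Filter.Eventually.of_forall hm)
    _ = κ := withDensity_one

/-- A singleton lies in half-open intervals of arbitrarily small length. -/
lemma measure_singleton (h : IsRadial κ) (t : ℝ) : κ {t} = 0 := by
  obtain ⟨M, hM⟩ := h.lip (t + 1)
  have h1 (ε : ℝ) (h0 : 0 < ε) (hε : ε ≤ 1) : κ {t} ≤ M * ENNReal.ofReal ε := by
    have h2 := hM t (t + ε) (by linarith) (by linarith)
    rw [add_sub_cancel_left] at h2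
    refine (measure_mono ?_).trans h2
    intro x hx
    rw [mem_singleton_iff.1 hx]
    exact ⟨le_rfl, by linarith⟩
  have h2 : Filter.Tendsto (fun ε : ℝ => (M : ℝ≥0∞) * ENNReal.ofReal ε) (nhdsWithin 0 (Ioi 0))
      (nhds 0) := by
    have : Filter.Tendsto (fun ε : ℝ => (M : ℝ≥0∞) * ENNReal.ofReal ε) (nhds 0)
        (nhds (M * ENNReal.ofReal 0)) :=
      ENNReal.Tendsto.const_mul (ENNReal.continuous_ofReal.tendsto 0) (Or.inr (by simp))
    simp only [ENNReal.ofReal_zero, mul_zero] at this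
    exact this.mono_left nhdsWithin_le_nhds
  refine le_antisymm (ge_of_tendsto h2 ?_) zero_le
  filter_upwards [Ioo_mem_nhdsGT (zero_lt_one' ℝ)] with ε hε
  exact h1 ε hε.1 hε.2.le

lemma measurable_measure_Iio (κ : Measure ℝ) : Measurable fun t => κ (Iio t) :=
  have h : Monotone fun t => κ (Iio t) := fun _ _ h => measure_mono (Iio_subset_Iio h)
  h.measurable

lemma measure_Ico (h : IsRadial κ) {s t : ℝ} (hst : s ≤ t) :
    (κ (Iio t)).toReal - (κ (Iio s)).toReal = (κ (Ico s t)).toReal := by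
  have h1 : κ (Iio t) = κ (Iio s) + κ (Ico s t) := by
    rw [← Iio_union_Ico_eq_Iio hst, measure_union _ measurableSet_Ico]
    exact (Iio_disjoint_Ici le_rfl).mono_right Ico_subset_Ici_self
  have h2 : κ (Ico s t) ≠ ∞ :=
    ne_top_of_le_ne_top (h.measure_Iio_ne_top t) (measure_mono fun x hx => hx.2)
  rw [h1, ENNReal.toReal_add (h.measure_Iio_ne_top s) h2]
  ring

/-- With `K(t) = κ(Iio t)`, this integrates `d(-e^{-K}) = e^{-K} dκ`, in additive form to avoid
truncated subtraction. It converts the tail of the nearest distance into a density. -/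
lemma withDensity_eneg_Ico (h : IsRadial κ) {a b : ℝ} (hab : a ≤ b) :
    (κ.withDensity fun t => eneg (κ (Iio t))) (Ico a b) + eneg (κ (Iio b)) = eneg (κ (Iio a)) := by
  set ρ := κ.withDensity fun t => eneg (κ (Iio t)) with hρ
  have hρr : IsRadial ρ := h.withDensity fun t => eneg_le_one _
  set K : ℝ → ℝ := fun t => (κ (Iio t)).toReal with hK
  have hKe (t : ℝ) : eneg (κ (Iio t)) = ENNReal.ofReal (Real.exp (-K t)) := by
    rw [← eneg_ofReal ENNReal.toReal_nonneg, ENNReal.ofReal_toReal (h.measure_Iio_ne_top t)]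
  -- With `δ = κ [s, t)`, the increment `r` of `ρ` lies between `e^{-K(t)} δ` and `e^{-K(s)} δ`,
  -- while `e^{-K}` drops by `e^{-K(s)} (1 - e^{-δ})`. The two cancel up to `δ²`, which is at most
  -- `M² (t - s)²`.
  have hmain := const_of_abs_sub_le_sq (f := fun t => (ρ (Iio t)).toReal + Real.exp (-K t)) (by
    intro B
    obtain ⟨M, hM⟩ := h.lip B
    refine ⟨M ^ 2, fun s t hst htB => ?_⟩
    have hκ : κ (Ico s t) ≠ ∞ :=
      ne_top_of_le_ne_top (h.measure_Iio_ne_top t) (measure_mono fun x hx => hx.2)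
    have hδ := h.measure_Ico hst
    have hr := hρr.measure_Ico hst
    set δ := (κ (Ico s t)).toReal with hδd
    set r := (ρ (Ico s t)).toReal with hrd
    have hδ0 : 0 ≤ δ := ENNReal.toReal_nonneg
    have hδM : δ ≤ M * (t - s) := by
      refine ENNReal.toReal_le_of_le_ofReal (mul_nonneg M.2 (by linarith)) ?_
      rw [ENNReal.ofReal_mul M.coe_nonneg]
      simpa using hM s t hst htB
    have hρ1 : ρ (Ico s t) = ∫⁻ x in Ico s t, eneg (κ (Iio x)) ∂κ :=
      withDensity_apply _ measurableSet_Ico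
    have hup : r ≤ Real.exp (-K s) * δ := by
      refine ENNReal.toReal_le_of_le_ofReal (by positivity) ?_
      rw [ENNReal.ofReal_mul (by positivity), ENNReal.ofReal_toReal hκ, ← hKe, hρ1,
        ← setLIntegral_const]
      exact setLIntegral_mono measurable_const fun x hx =>
        eneg_antitone (measure_mono (Iio_subset_Iio hx.1))
    have hlow : Real.exp (-K t) * δ ≤ r := by
      have hρf : ρ (Ico s t) ≠ ∞ :=
        ne_top_of_le_ne_top (hρr.measure_Iio_ne_top t) (measure_mono fun x hx => hx.2)
      rw [hrd, ← ENNReal.ofReal_le_iff_le_toReal hρf,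
        ENNReal.ofReal_mul (by positivity), ENNReal.ofReal_toReal hκ, ← hKe, hρ1,
        ← setLIntegral_const]
      exact setLIntegral_mono (measurable_eneg.comp (measurable_measure_Iio κ)) fun x hx =>
        eneg_antitone (measure_mono (Iio_subset_Iio hx.2.le))
    have hKt : K t = K s + δ := by simp only [hK]; linarith
    have e1 : Real.exp (-K t) = Real.exp (-K s) * Real.exp (-δ) := by
      rw [← Real.exp_add, hKt]; ring_nf
    have e2 : Real.exp (-K s) ≤ 1 := Real.exp_le_one_iff.2 (by simp [hK])
    have e3 : 1 - δ ≤ Real.exp (-δ) := by linarith [Real.add_one_le_exp (-δ)]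
    -- From `e^δ ≥ 1 + δ` and `(1 + δ)(1 - δ + δ²) = 1 + δ³ ≥ 1`.
    have e4 : Real.exp (-δ) ≤ 1 - δ + δ ^ 2 := by
      rw [Real.exp_neg, inv_le_comm₀ (Real.exp_pos _) (by nlinarith)]
      refine le_trans ?_ (Real.add_one_le_exp δ)
      rw [inv_le_iff_one_le_mul₀ (by nlinarith)]
      nlinarith [pow_nonneg hδ0 3]
    have e5 := Real.exp_pos (-K s)
    have hsq : δ ^ 2 ≤ M ^ 2 * (t - s) ^ 2 := by
      rw [← mul_pow]; exact pow_le_pow_left₀ hδ0 hδM 2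
    refine le_trans ?_ hsq
    rw [abs_le]
    rw [e1] at hlow ⊢
    constructor
    · nlinarith [mul_nonneg e5.le (mul_nonneg hδ0 (sub_nonneg.2 e3)), mul_nonneg (sub_nonneg.2 e2) (sq_nonneg δ),
        mul_nonneg e5.le (sub_nonneg.2 e3)]
    · nlinarith [mul_nonneg e5.le (sub_nonneg.2 e4), mul_nonneg (sub_nonneg.2 e2) (sq_nonneg δ)]) a b
  have h3 := hρr.measure_Ico hab
  have hfin : ρ (Ico a b) ≠ ∞ :=
      ne_top_of_le_ne_top (hρr.measure_Iio_ne_top b) (measure_mono fun x hx => hx.2)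
  rw [hKe, hKe, ← ENNReal.ofReal_toReal hfin, ← ENNReal.ofReal_add ENNReal.toReal_nonneg
    (Real.exp_pos _).le]
  congr 1
  linarith

end IsRadial

/-! ### Polar coordinates -/

/-- The plane minus the origin is the product of the unit circle and the half-line; the circle has
mass twice the area of the unit disc, and the radial measure has density `t`. -/
lemma lintegral_norm_plane {f : ℝ → ℝ≥0∞} (hf : Measurable f) :
    ∫⁻ z : Plane, f ‖z‖ = ENNReal.ofReal (2 * Real.pi) * ∫⁻ t in Ioi (0 : ℝ), f t * ENNReal.ofReal t := by
  have hdim : Module.finrank ℝ Plane = 2 := by simp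
  calc ∫⁻ z : Plane, f ‖z‖
      = ∫⁻ z : ({(0)}ᶜ : Set Plane), f ‖z.1‖ ∂((volume : Measure Plane).comap (↑)) := by
        rw [lintegral_subtype_comap (measurableSet_singleton _).compl fun z : Plane => f ‖z‖,
          restrict_compl_singleton]
    _ = ∫⁻ q, f q.2 ∂((volume : Measure Plane).toSphere.prod (.volumeIoiPow (Module.finrank ℝ Plane - 1))) := by
        have := (volume : Measure Plane).measurePreserving_homeomorphUnitSphereProd.lintegral_comp_emb
          (Homeomorph.measurableEmbedding _) (f ∘ Subtype.val ∘ Prod.snd)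
        simpa using this
    _ = (volume : Measure Plane).toSphere univ *
          ∫⁻ t : Ioi (0 : ℝ), f t ∂(.volumeIoiPow (Module.finrank ℝ Plane - 1)) := by
        rw [lintegral_prod_symm' _ (by fun_prop)]
        simp only [lintegral_const]
        rw [lintegral_mul_const _ (by fun_prop), mul_comm]
    _ = _ := by
        rw [Measure.toSphere_apply_univ, hdim, Measure.volumeIoiPow,
          lintegral_withDensity_eq_lintegral_mul _ (by fun_prop) (by fun_prop),
          EuclideanSpace.volume_ball_fin_two]
        congr 1
        · rw [ENNReal.ofReal_mul (by norm_num)]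
          simp
        · rw [← lintegral_subtype_comap measurableSet_Ioi (fun t => f t * ENNReal.ofReal t)]
          simp [mul_comm]

namespace Network

variable {W : Type*} (net : Network W)

lemma measurable_linkProb (j : W) (z : Sight) : Measurable (net.linkProb j z) := by
  cases z
  · exact net.p_measurable j
  · exact measurable_const.sub (net.p_measurable j)

lemma linkProb_nonneg (j : W) (z : Sight) (t : ℝ) : 0 ≤ net.linkProb j z t := by
  cases z
  · exact net.p_nonneg j t
  · exact sub_nonneg.2 (net.p_le_one j t)

lemma linkProb_le_one (j : W) (z : Sight) (t : ℝ) : net.linkProb j z t ≤ 1 := by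
  cases z
  · exact net.p_le_one j t
  · exact sub_le_self _ (net.p_nonneg j t)

/-- Intensity measure of the distances of the base stations of a class. -/
def radial (j : W) (z : Sight) : Measure ℝ := (net.intensity j z).map norm

lemma radial_eq (j : W) (z : Sight) :
    net.radial j z = (volume.restrict (Ioi (0 : ℝ))).withDensity
      fun t => ENNReal.ofReal (2 * Real.pi * net.lam j * net.linkProb j z t * t) := by
  have hp := net.measurable_linkProb j z
  ext B hB
  have h1 : ∫⁻ z_1 : Plane, (norm ⁻¹' B).indicator
        (fun a => ENNReal.ofReal (net.lam j * net.linkProb j z ‖a‖)) z_1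
      = ∫⁻ z_1 : Plane, (B.indicator
        (fun t => ENNReal.ofReal (net.lam j * net.linkProb j z t))) ‖z_1‖ := rfl
  rw [radial, Measure.map_apply measurable_norm hB, Network.intensity,
    withDensity_apply _ (measurable_norm hB), withDensity_apply _ hB,
    ← lintegral_indicator (measurable_norm hB), h1,
    lintegral_norm_plane (Measurable.indicator (by fun_prop) hB),
    ← lintegral_const_mul _ (by fun_prop (disch := assumption)), ← lintegral_indicator hB]
  refine setLIntegral_congr_fun measurableSet_Ioi fun t ht => ?_
  by_cases htB : t ∈ B
  · have := net.linkProb_nonneg j z t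
    have := net.lam_nonneg j
    have := Real.pi_pos
    simp only [indicator_of_mem htB]
    rw [← ENNReal.ofReal_mul (by positivity), ← ENNReal.ofReal_mul (by positivity)]
    congr 1; ring
  · simp [htB]

lemma isRadial_radial (j : W) (z : Sight) : IsRadial (net.radial j z) := by
  rw [radial_eq]
  constructor
  · rw [withDensity_apply _ measurableSet_Iio, Measure.restrict_restrict measurableSet_Iio,
      show Iio (0 : ℝ) ∩ Ioi 0 = ∅ from disjoint_iff_inter_eq_empty.1
        ((Iio_disjoint_Ici le_rfl).mono_right Ioi_subset_Ici_self), Measure.restrict_empty, lintegral_zero_measure]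
  · intro b
    have := net.lam_nonneg j
    have := Real.pi_pos
    refine ⟨(2 * Real.pi * net.lam j * 1 * max b 0).toNNReal, fun s t hst htb => ?_⟩
    rw [withDensity_apply _ measurableSet_Ico, Measure.restrict_restrict measurableSet_Ico]
    calc ∫⁻ x in Ico s t ∩ Ioi 0, ENNReal.ofReal (2 * Real.pi * net.lam j * net.linkProb j z x * x)
        ≤ ∫⁻ x in Ico s t ∩ Ioi 0, ENNReal.ofReal (2 * Real.pi * net.lam j * 1 * max b 0) := by
          refine setLIntegral_mono measurable_const fun x hx => ENNReal.ofReal_le_ofReal ?_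
          have h0 : 0 < x := hx.2
          have h1 : x ≤ max b 0 := le_max_of_le_left (hx.1.2.le.trans htb)
          have := net.linkProb_le_one j z x
          gcongr
      _ = ENNReal.ofReal (2 * Real.pi * net.lam j * 1 * max b 0) * volume (Ico s t ∩ Ioi 0) := by
          rw [setLIntegral_const]
      _ ≤ _ := by
          refine mul_le_mul' le_rfl ((measure_mono inter_subset_left).trans_eq Real.volume_Ico)

instance (j : W) (z : Sight) : SigmaFinite (net.intensity j z) := by
  unfold intensity
  infer_instance

end Network

/-! ### The nearest point of a configuration in the plane -/

/-- Distance from the origin to the nearest point of a configuration. -/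
def nearest (p : ℕ∞ × (ℕ → Plane)) : ℝ≥0∞ :=
  ⨅ l : ℕ, if (l : ℕ∞) < p.1 then ENNReal.ofReal ‖p.2 l‖ else ∞

lemma measurable_nearest : Measurable nearest := by
  unfold nearest
  refine Measurable.iInf fun l => ?_
  refine Measurable.ite (measurableSet_present l) ?_ measurable_const
  exact ENNReal.measurable_ofReal.comp
    (measurable_norm.comp ((measurable_pi_apply l).comp measurable_snd))

lemma ofReal_le_nearest_iff {p : ℕ∞ × (ℕ → Plane)} {a : ℝ} :
    ENNReal.ofReal a ≤ nearest p ↔ ∀ l : ℕ, (l : ℕ∞) < p.1 → a ≤ ‖p.2 l‖ := by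
  rw [nearest, le_iInf_iff]
  refine forall_congr' fun l => ?_
  split_ifs with h
  · simp only [h, true_implies]
    exact ENNReal.ofReal_le_ofReal_iff (norm_nonneg _)
  · simp [h]

/-! ### Void events as infinite weights -/

/-- `v` outside the set `B`, and `∞` on `B`. -/
def kill {T : Type*} (B : Set T) (v : T → ℝ≥0∞) (r : T) : ℝ≥0∞ := by
  classical exact if r ∈ B then ∞ else v r

/-- A single point in `B` makes the sum infinite and its exponential zero. The void event of `B`
thus becomes part of a Laplace functional, to which `IsPoissonProcess.laplace` applies. -/
lemma eneg_psum_kill {E : Type*} (B : Set E) (v : E → ℝ≥0∞) (p : ℕ∞ × (ℕ → E)) :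
    eneg (psum (kill B v) p)
      = {p : ℕ∞ × (ℕ → E) | ∀ l : ℕ, (l : ℕ∞) < p.1 → p.2 l ∉ B}.indicator
          (fun p => eneg (psum v p)) p := by
  classical
  by_cases h : ∀ l : ℕ, (l : ℕ∞) < p.1 → p.2 l ∉ B
  · rw [indicator_of_mem (by exact h)]
    congr 1
    unfold psum
    congr 1 with l
    split_ifs with hl
    · simp [kill, h l hl]
    · rfl
  · rw [indicator_of_notMem (by exact h), eneg_eq_zero_iff]
    push Not at h
    obtain ⟨l, hl, hlB⟩ := h
    refine top_le_iff.1 (le_trans ?_ (ENNReal.le_tsum l))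
    simp [hl, kill, hlB]

lemma measurable_kill {T : Type*} [MeasurableSpace T] {B : Set T} (hB : MeasurableSet B)
    {v : T → ℝ≥0∞} (hv : Measurable v) : Measurable (kill B v) := by
  classical
  exact Measurable.ite hB measurable_const hv

lemma lintegral_kill {T : Type*} [MeasurableSpace T] {m : Measure T} {B : Set T}
    (hB : MeasurableSet B) (v : T → ℝ≥0∞) :
    ∫⁻ r, (1 - eneg (kill B v r)) ∂m
      = m B + ∫⁻ r in Bᶜ, (1 - eneg (v r)) ∂m := by
  classical
  rw [← lintegral_add_compl _ hB]
  congr 1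
  · rw [setLIntegral_congr_fun (g := fun _ => 1) hB (fun r hr => by simp [kill, hr])]
    simp
  · exact setLIntegral_congr_fun hB.compl (fun r hr => by simp [kill, show r ∉ B from hr])

/-- On the killed part the integrand is `1 = (1 - e^{-v}) + e^{-v}`. The first term completes the
integral of the unkilled functional; the second is the intensity thinned by `e^{-v}`. -/
lemma lintegral_kill' {m : Measure ℝ} {v : ℝ → ℝ≥0∞} (hv : Measurable v) (t : ℝ) :
    ∫⁻ r, (1 - eneg (kill (Iio t) v r)) ∂m
      = ∫⁻ r, (1 - eneg (v r)) ∂m + (m.withDensity fun r => eneg (v r)) (Iio t) := by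
  have h1 : Measurable fun r => 1 - eneg (v r) := measurable_const.sub (measurable_eneg.comp hv)
  rw [lintegral_kill measurableSet_Iio v, withDensity_apply _ measurableSet_Iio,
    ← lintegral_add_compl (μ := m) (fun r => 1 - eneg (v r)) (measurableSet_Iio (a := t)),
    add_right_comm,
    ← lintegral_add_left h1]
  congr 1
  rw [← setLIntegral_one]
  congr 1 with r
  exact (tsub_add_cancel_of_le (eneg_le_one _)).symm

/-- The probability is `1 - e^{-r}(1 + r)`, and `e^{-r} ≥ 1 - r` gives `e^{-r}(1 + r) ≥ 1 - r²`. -/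
lemma poissonMeasure_two_le (r : ℝ≥0) : poissonMeasure r {n | 2 ≤ n} ≤ (r : ℝ≥0∞) ^ 2 := by
  have h1 : {n : ℕ | 2 ≤ n} = ({0, 1} : Set ℕ)ᶜ := by
    ext n
    simp only [mem_ofPred_eq, mem_compl_iff, mem_insert_iff, mem_singleton_iff]
    omega
  rw [h1, prob_compl_eq_one_sub (by measurability), insert_eq, measure_union (by simp) (by simp),
    poissonMeasure_singleton, poissonMeasure_singleton, ← ENNReal.ofReal_add (by positivity)
    (by positivity), ← ENNReal.ofReal_one, ← ENNReal.ofReal_sub _ (by positivity)]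
  rw [show (r : ℝ≥0∞) ^ 2 = ENNReal.ofReal ((r : ℝ) ^ 2) by
    rw [ENNReal.ofReal_pow r.coe_nonneg, ENNReal.ofReal_coe_nnreal]]
  apply ENNReal.ofReal_le_ofReal
  have h2 := Real.add_one_le_exp (-(r : ℝ))
  have := r.coe_nonneg
  simp
  nlinarith [mul_le_mul_of_nonneg_right h2 (by linarith : 0 ≤ 1 + (r : ℝ))]

namespace IsPoissonProcess

variable {Ω : Type*} [MeasurableSpace Ω] {μ : Measure Ω} {Λ : Measure Plane} {N : Ω → ℕ∞}
  {X : ℕ → Ω → Plane}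

lemma lintegral_eneg_kill [SigmaFinite Λ] [IsProbabilityMeasure μ] (h : IsPoissonProcess μ Λ N X)
    {B : Set ℝ} (hB : MeasurableSet B) {v : ℝ → ℝ≥0∞} (hv : Measurable v) :
    ∫⁻ ω, eneg (psum (fun z => kill B v ‖z‖) (N ω, fun l => X l ω)) ∂μ
      = eneg (∫⁻ r, (1 - eneg (kill B v r)) ∂(Λ.map norm)) := by
  have h1 := measurable_kill hB hv
  rw [h.laplace (u := fun z => kill B v ‖z‖) (h1.comp measurable_norm), lintegral_map
    (f := fun r => 1 - eneg (kill B v r)) (measurable_const.sub (measurable_eneg.comp h1))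
    measurable_norm]

/-- The joint law of the distance to the nearest point and of the Laplace functional. -/
lemma lintegral_nearest [SigmaFinite Λ] [IsProbabilityMeasure μ] (h : IsPoissonProcess μ Λ N X)
    (hΛ : IsRadial (Λ.map norm)) {v : ℝ → ℝ≥0∞} (hv : Measurable v) {f : ℝ → ℝ≥0∞}
    (hf : Measurable f) :
    ∫⁻ ω in {ω | nearest (N ω, fun l => X l ω) ≠ ∞},
        f (nearest (N ω, fun l => X l ω)).toReal
          * eneg (psum (fun z => v ‖z‖) (N ω, fun l => X l ω)) ∂μ
      = ∫⁻ t, f t * (eneg (v t) * eneg (∫⁻ r, (1 - eneg (kill (Iio t) v r)) ∂(Λ.map norm)))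
          ∂(Λ.map norm) := by
  set R : Ω → ℝ≥0∞ := fun ω => nearest (N ω, fun l => X l ω) with hR
  set Z : Ω → ℝ≥0∞ := fun ω => eneg (psum (fun z => v ‖z‖) (N ω, fun l => X l ω)) with hZ
  set κ := (Λ.map norm).withDensity fun r => eneg (v r) with hκ
  set Q := ∫⁻ r, (1 - eneg (v r)) ∂(Λ.map norm) with hQ
  have hRm : Measurable R := measurable_nearest.comp h.measurable_config
  have hZm : Measurable Z :=
    measurable_eneg.comp ((measurable_psum (hv.comp measurable_norm)).comp h.measurable_config)
  have hev : Measurable fun r => eneg (v r) := measurable_eneg.comp hv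
  have hκr : IsRadial κ := hΛ.withDensity fun r => eneg_le_one _
  have hfinset : MeasurableSet {ω | R ω ≠ ∞} := hRm (measurableSet_singleton _).compl
  -- The law of the nearest distance weighted by `Z`, off the event that there is no point. The
  -- claim amounts to `ν` having density `D` with respect to `κ`.
  set ν := ((μ.withDensity Z).restrict {ω | R ω ≠ ∞}).map (fun ω => (R ω).toReal) with hν
  set D : ℝ → ℝ≥0∞ := fun t => eneg Q * eneg (κ (Iio t)) with hD
  have hDm : Measurable D :=
    (measurable_eneg.comp (IsRadial.measurable_measure_Iio κ)).const_mul _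
  have hRa (a : ℝ) : MeasurableSet {ω | ENNReal.ofReal a ≤ R ω} :=
    measurableSet_le measurable_const hRm
  -- `R ≥ a` is the void event of the open disc of radius `a`, so the tail is a Laplace functional
  -- with the weight killed on `Iio a`.
  have htail (a : ℝ) : ∫⁻ ω in {ω | ENNReal.ofReal a ≤ R ω}, Z ω ∂μ = eneg (Q + κ (Iio a)) := by
    rw [← lintegral_kill' hv, ← h.lintegral_eneg_kill measurableSet_Iio hv,
      ← lintegral_indicator (hRa a)]
    congr 1 with ω
    have := eneg_psum_kill (norm ⁻¹' (Iio a)) (fun z : Plane => v ‖z‖) (N ω, fun l => X l ω)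
    rw [show kill (norm ⁻¹' (Iio a)) (fun z : Plane => v ‖z‖) = fun z => kill (Iio a) v ‖z‖ from rfl]
      at this
    rw [this]
    have hiff : ENNReal.ofReal a ≤ R ω ↔ ∀ l : ℕ, (l : ℕ∞) < N ω → X l ω ∉ norm ⁻¹' Iio a := by
      rw [hR]
      simp only [ofReal_le_nearest_iff, mem_preimage, mem_Iio, not_lt]
    simp only [indicator, mem_ofPred_eq, hZ]
    by_cases h1 : ENNReal.ofReal a ≤ R ω
    · rw [if_pos h1, if_pos (hiff.1 h1)]
    · rw [if_neg h1, if_neg (fun h2 => h1 (hiff.2 h2))]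
  have hνIco (a b : ℝ) (hab : a < b) : ν (Ico a b) + eneg (Q + κ (Iio b)) = eneg (Q + κ (Iio a)) := by
    have hm1 : MeasurableSet {ω | (R ω).toReal ∈ Ico a b} :=
      hRm.ennreal_toReal measurableSet_Ico
    have hsplit : {ω | ENNReal.ofReal a ≤ R ω}
        = ({ω | (R ω).toReal ∈ Ico a b} ∩ {ω | R ω ≠ ∞}) ∪ {ω | ENNReal.ofReal b ≤ R ω} := by
      ext ω
      simp only [mem_ofPred_eq, mem_union, mem_inter_iff, mem_Ico]
      by_cases hω : R ω = ∞
      · simp [hω]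
      · rw [ENNReal.ofReal_le_iff_le_toReal hω, ENNReal.ofReal_le_iff_le_toReal hω]
        constructor
        · intro h1
          rcases lt_or_ge (R ω).toReal b with h2 | h2
          · exact Or.inl ⟨⟨h1, h2⟩, hω⟩
          · exact Or.inr h2
        · rintro (h1 | h1)
          · exact h1.1.1
          · linarith
    have hdisj : Disjoint ({ω | (R ω).toReal ∈ Ico a b} ∩ {ω | R ω ≠ ∞})
        {ω | ENNReal.ofReal b ≤ R ω} := by
      rw [disjoint_left]
      rintro ω ⟨h1, h2⟩ h3
      have := (ENNReal.ofReal_le_iff_le_toReal h2).1 h3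
      exact absurd h1.2 (not_lt.2 this)
    rw [← htail, ← htail, hsplit, lintegral_union (hRa b) hdisj, hν,
      Measure.map_apply hRm.ennreal_toReal measurableSet_Ico,
      Measure.restrict_apply (hRm.ennreal_toReal measurableSet_Ico),
      withDensity_apply _ ((hRm.ennreal_toReal measurableSet_Ico).inter hfinset)]
    rfl
  -- Both measures have the same increments of the tail `e^{-Q - κ(Iio ·)}`, and `ν` is finite, so
  -- agreement on intervals suffices.
  have hνeq : ν = κ.withDensity D := by
    have : IsFiniteMeasure (μ.withDensity Z) := by
      refine isFiniteMeasure_withDensity (ne_top_of_le_ne_top ENNReal.one_ne_top ?_)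
      calc ∫⁻ ω, Z ω ∂μ ≤ ∫⁻ _, 1 ∂μ := lintegral_mono fun ω => eneg_le_one _
        _ = 1 := by simp
    have : IsFiniteMeasure ν := by rw [hν]; infer_instance
    refine Measure.ext_of_Ico _ _ fun a b hab => ?_
    have h2 : κ.withDensity D (Ico a b) + eneg (Q + κ (Iio b)) = eneg (Q + κ (Iio a)) := by
      rw [eneg_add, eneg_add, ← hκr.withDensity_eneg_Ico hab.le, mul_add,
        withDensity_apply _ measurableSet_Ico, withDensity_apply _ measurableSet_Ico,
        lintegral_const_mul (f := fun t => eneg (κ (Iio t))) _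
          (measurable_eneg.comp (IsRadial.measurable_measure_Iio κ))]
    exact (ENNReal.add_left_inj (eneg_ne_top _)).1 ((hνIco a b hab).trans h2.symm)
  have hL : ∫⁻ ω in {ω | R ω ≠ ∞}, f (R ω).toReal * Z ω ∂μ = ∫⁻ t, f t ∂ν := by
    rw [hν, lintegral_map hf hRm.ennreal_toReal, restrict_withDensity hfinset,
      lintegral_withDensity_eq_lintegral_mul (g := fun ω => f (R ω).toReal) _ hZm
        (hf.comp hRm.ennreal_toReal)]
    simp [mul_comm]
  rw [hL, hνeq, lintegral_withDensity_eq_lintegral_mul _ hDm hf,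
    lintegral_withDensity_eq_lintegral_mul _ hev (hDm.mul hf)]
  congr 1 with t
  simp only [Pi.mul_apply, hD]
  rw [lintegral_kill' hv, eneg_add]
  ring

/-- Almost surely, the points of the process have distinct distances to the origin. -/
lemma ae_norm_injective [IsProbabilityMeasure μ] (h : IsPoissonProcess μ Λ N X)
    (hΛ : IsRadial (Λ.map norm)) :
    ∀ᵐ ω ∂μ, ∀ l l' : ℕ, l ≠ l' → (l : ℕ∞) < N ω → (l' : ℕ∞) < N ω → ‖X l ω‖ ≠ ‖X l' ω‖ := by
  set T : ℝ → Set Ω := fun t => {ω | ∃ l l' : ℕ, l ≠ l' ∧ (l : ℕ∞) < N ω ∧ (l' : ℕ∞) < N ω ∧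
    ‖X l ω‖ = ‖X l' ω‖ ∧ ‖X l ω‖ < t} with hT
  have hmono : Monotone T := by
    rintro s t hst ω ⟨l, l', h1, h2, h3, h4, h5⟩
    exact ⟨l, l', h1, h2, h3, h4, h5.trans_le hst⟩
  -- A coincidence below `t` but not below `s` puts two points into the annulus `[s, t)`, which has
  -- probability at most the square of its intensity. The probability of `T` therefore has quadratic
  -- increments and is constant, equal to its value at `0`.
  have hstep (s t : ℝ) : μ (T t) ≤ μ (T s) + (Λ.map norm (Ico s t)) ^ 2 := by
    by_cases hfin : Λ.map norm (Ico s t) = ∞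
    · simp [hfin]
    have hmap : Λ.map norm (Ico s t) = Λ (norm ⁻¹' (Ico s t)) :=
      Measure.map_apply measurable_norm measurableSet_Ico
    have hB : MeasurableSet (norm ⁻¹' (Ico s t) : Set Plane) := measurable_norm measurableSet_Ico
    have h1 : T t ⊆ T s ∪ {ω | 2 ≤ count N X (norm ⁻¹' (Ico s t)) ω} := by
      rintro ω ⟨l, l', h1, h2, h3, h4, h5⟩
      rcases lt_or_ge ‖X l ω‖ s with h6 | h6
      · exact Or.inl ⟨l, l', h1, h2, h3, h4, h6⟩
      · refine Or.inr ?_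
        have : ({l, l'} : Set ℕ) ⊆ {l : ℕ | (l : ℕ∞) < N ω ∧ X l ω ∈ norm ⁻¹' (Ico s t)} := by
          rintro k (rfl | rfl)
          · exact ⟨h2, h6, h5⟩
          · exact ⟨h3, by rw [mem_preimage, ← h4]; exact ⟨h6, h5⟩⟩
        have h7 := encard_le_encard this
        rwa [encard_pair h1] at h7
    refine (measure_mono h1).trans ((measure_union_le _ _).trans (add_le_add le_rfl ?_))
    rw [hmap] at hfin ⊢
    have h2 := h.lintegral_count hB hfin (({n | 2 ≤ n} : Set ℕ∞).indicator 1)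
    have h3 : ∫⁻ ω, ({n | 2 ≤ n} : Set ℕ∞).indicator 1 (count N X (norm ⁻¹' (Ico s t)) ω) ∂μ
        = μ {ω | 2 ≤ count N X (norm ⁻¹' (Ico s t)) ω} :=
      lintegral_indicator_one (h.measurable_count hB (MeasurableSet.of_discrete (s := {n | 2 ≤ n})))
    have h4 : ∫⁻ n : ℕ, ({n | 2 ≤ n} : Set ℕ∞).indicator 1 (n : ℕ∞)
        ∂(poissonMeasure (Λ (norm ⁻¹' (Ico s t))).toNNReal)
        = poissonMeasure (Λ (norm ⁻¹' (Ico s t))).toNNReal {n | 2 ≤ n} := by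
      rw [← lintegral_indicator_one (α := ℕ) MeasurableSet.of_discrete]
      refine lintegral_congr fun n => ?_
      simp [indicator]
    rw [← h3, h2, h4]
    refine (poissonMeasure_two_le _).trans ?_
    rw [ENNReal.coe_toNNReal hfin]
  have hconst := const_of_abs_sub_le_sq (f := fun t => (μ (T t)).toReal) (by
    intro b
    obtain ⟨M, hM⟩ := hΛ.lip b
    refine ⟨M ^ 2, fun s t hst htb => ?_⟩
    have h1 : μ (T t) ≤ μ (T s) + ENNReal.ofReal (M ^ 2 * (t - s) ^ 2) := by
      refine (hstep s t).trans (add_le_add le_rfl ?_)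
      refine (pow_le_pow_left' (hM s t hst htb) 2).trans_eq ?_
      rw [← mul_pow, ENNReal.ofReal_pow (mul_nonneg M.coe_nonneg (sub_nonneg.2 hst)),
        ENNReal.ofReal_mul M.coe_nonneg]
      simp
    have h2 : (μ (T s)).toReal ≤ (μ (T t)).toReal :=
      ENNReal.toReal_mono (measure_ne_top _ _) (measure_mono (hmono hst))
    rw [abs_of_nonneg (by linarith)]
    have h3 := ENNReal.toReal_mono
      (ENNReal.add_ne_top.2 ⟨measure_ne_top _ _, ENNReal.ofReal_ne_top⟩) h1
    rw [ENNReal.toReal_add (measure_ne_top _ _) ENNReal.ofReal_ne_top, ENNReal.toReal_ofReal (by positivity)] at h3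
    linarith)
  have hT0 : T 0 = ∅ := by
    ext ω
    simp only [hT, mem_ofPred_eq, mem_empty_iff_false, iff_false]
    rintro ⟨l, l', h1, h2, h3, h4, h5⟩
    exact absurd h5 (not_lt.2 (norm_nonneg _))
  have hnull (n : ℕ) : μ (T n) = 0 := by
    have := hconst n 0
    simp only [hT0, measure_empty, ENNReal.toReal_zero] at this
    exact ((ENNReal.toReal_eq_zero_iff _).1 this).resolve_right (measure_ne_top _ _)
  have hall : ∀ᵐ ω ∂μ, ∀ n : ℕ, ω ∉ T n := ae_all_iff.2 fun n => by
    rw [ae_iff]; simpa using hnull n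
  filter_upwards [hall] with ω hω l l' h1 h2 h3 h4
  obtain ⟨n, hn⟩ := exists_nat_gt ‖X l ω‖
  exact hω n ⟨l, l', h1, h2, h3, h4, hn⟩

/-- Almost surely, bounded sets contain finitely many points of the process. -/
lemma ae_finite (h : IsPoissonProcess μ Λ N X) (hΛ : IsRadial (Λ.map norm)) :
    ∀ᵐ ω ∂μ, ∀ b : ℝ, {l : ℕ | (l : ℕ∞) < N ω ∧ ‖X l ω‖ < b}.Finite := by
  have h1 (n : ℕ) : ∀ᵐ ω ∂μ, count N X (norm ⁻¹' (Iio (n : ℝ))) ω ≠ ⊤ := by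
    have hB : MeasurableSet (norm ⁻¹' (Iio (n : ℝ)) : Set Plane) := measurable_norm measurableSet_Iio
    have hfin : Λ (norm ⁻¹' (Iio (n : ℝ))) ≠ ∞ := by
      rw [← Measure.map_apply measurable_norm measurableSet_Iio]
      exact hΛ.measure_Iio_ne_top _
    have h2 := h.lintegral_count hB hfin (({⊤} : Set ℕ∞).indicator 1)
    have h3 : ∫⁻ ω, ({⊤} : Set ℕ∞).indicator 1 (count N X (norm ⁻¹' (Iio (n : ℝ))) ω) ∂μ
        = μ {ω | count N X (norm ⁻¹' (Iio (n : ℝ))) ω = ⊤} :=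
      lintegral_indicator_one (h.measurable_count hB (MeasurableSet.of_discrete (s := {⊤})))
    rw [ae_iff]
    simp only [ne_eq, not_not]
    rw [← h3, h2]
    simp
  filter_upwards [ae_all_iff.2 h1] with ω hω b
  obtain ⟨n, hn⟩ := exists_nat_gt b
  refine (encard_ne_top_iff.1 (hω n)).subset fun l hl => ⟨hl.1, ?_⟩
  exact hl.2.trans hn

/-- Almost surely, no point of the process is at the origin. -/
lemma ae_norm_pos [SigmaFinite Λ] [IsProbabilityMeasure μ] (h : IsPoissonProcess μ Λ N X)
    (hΛ : IsRadial (Λ.map norm)) :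
    ∀ᵐ ω ∂μ, ∀ l : ℕ, (l : ℕ∞) < N ω → 0 < ‖X l ω‖ := by
  -- The void probability of the origin is `e^{-0} = 1`; a variable bounded by `1` with mean `1`
  -- equals `1` almost surely.
  have h1 := h.lintegral_eneg_kill (B := {0}) (measurableSet_singleton _) (v := 0) measurable_zero
  rw [lintegral_kill (measurableSet_singleton _) 0, hΛ.measure_singleton] at h1
  simp only [Pi.zero_apply, eneg_zero, tsub_self, lintegral_zero, add_zero] at h1
  have hm : Measurable fun ω => eneg (psum (fun z => kill {0} 0 ‖z‖) (N ω, fun l => X l ω)) :=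
    measurable_eneg.comp ((measurable_psum ((measurable_kill (measurableSet_singleton (0 : ℝ))
      measurable_zero).comp measurable_norm)).comp h.measurable_config)
  have h2 : ∀ᵐ ω ∂μ, eneg (psum (fun z => kill {0} 0 ‖z‖) (N ω, fun l => X l ω)) = 1 := by
    refine ae_eq_of_ae_le_of_lintegral_le (Filter.Eventually.of_forall fun ω => eneg_le_one _)
      (by simp [h1]) (by fun_prop) (by simp [h1])
  filter_upwards [h2] with ω hω l hl
  have h3 := eneg_psum_kill (norm ⁻¹' {0}) (fun z : Plane => 0) (N ω, fun l => X l ω)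
  rw [show kill (norm ⁻¹' {0}) (fun z : Plane => 0) = fun z => kill {0} 0 ‖z‖ from rfl, hω] at h3
  have h4 := mem_of_indicator_ne_zero (h3 ▸ one_ne_zero)
  have h5 := h4 l hl
  exact lt_of_le_of_ne (norm_nonneg _) (fun h => h5 h.symm)

end IsPoissonProcess

/-! ### Integration of independent families -/

instance : Fintype Sight where
  elems := Finset.cons Sight.los (Finset.cons Sight.nlos ∅ (by simp)) (by simp)
  complete z := by cases z <;> simp

/-- Tonelli for the product law, with the second variable resampled on the same space. This form
allows one variable to be frozen while the other is averaged. -/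
lemma lintegral_indepFun {Ω A B : Type*} [MeasurableSpace Ω] [MeasurableSpace A]
    [MeasurableSpace B] {μ : Measure Ω} [IsProbabilityMeasure μ] {X : Ω → A} {Y : Ω → B}
    (hX : Measurable X) (hY : Measurable Y) (h : IndepFun X Y μ) {f : A → B → ℝ≥0∞}
    (hf : Measurable (Function.uncurry f)) :
    ∫⁻ ω, f (X ω) (Y ω) ∂μ = ∫⁻ ω, ∫⁻ ω', f (X ω) (Y ω') ∂μ ∂μ := by
  have h1 := (indepFun_iff_map_prod_eq_prod_map_map hX.aemeasurable hY.aemeasurable).1 h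
  have := Measure.isProbabilityMeasure_map (μ := μ) hX.aemeasurable
  have := Measure.isProbabilityMeasure_map (μ := μ) hY.aemeasurable
  calc ∫⁻ ω, f (X ω) (Y ω) ∂μ = ∫⁻ q, Function.uncurry f q ∂(μ.map fun ω => (X ω, Y ω)) := by
        rw [lintegral_map hf (hX.prodMk hY)]; rfl
    _ = ∫⁻ a, ∫⁻ b, f a b ∂(μ.map Y) ∂(μ.map X) := by
        rw [h1, lintegral_prod _ hf.aemeasurable]; rfl
    _ = ∫⁻ ω, ∫⁻ ω', f (X ω) (Y ω') ∂μ ∂μ := by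
        have h2 : Measurable fun a => ∫⁻ b, f a b ∂(μ.map Y) := hf.lintegral_prod_right'
        rw [lintegral_map h2 hX]
        refine lintegral_congr fun ω => ?_
        rw [lintegral_map (f := f (X ω)) (hf.comp (measurable_const.prodMk measurable_id)) hY]

/-- With the variable `i₀` frozen, the remaining factors are independent and can be averaged one by
one, although all of them depend on it. It is applied with `i₀` the serving class, whose nearest
distance fixes the forbidden discs of the others. -/
lemma lintegral_iIndepFun_erase {Ω ι C : Type*} [MeasurableSpace Ω] [MeasurableSpace C] [Fintype ι]
    [DecidableEq ι] {μ : Measure Ω} [IsProbabilityMeasure μ] {X : ι → Ω → C}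
    (hX : ∀ i, Measurable (X i)) (h : iIndepFun X μ) (i₀ : ι) {A : C → ℝ≥0∞} (hA : Measurable A)
    {P : C → ι → C → ℝ≥0∞} (hP : ∀ i, Measurable fun q : C × C => P q.1 i q.2) :
    ∫⁻ ω, A (X i₀ ω) * ∏ i ∈ Finset.univ.erase i₀, P (X i₀ ω) i (X i ω) ∂μ
      = ∫⁻ ω, A (X i₀ ω) * ∏ i ∈ Finset.univ.erase i₀, ∫⁻ ω', P (X i₀ ω) i (X i ω') ∂μ ∂μ := by
  set T : Finset ι := Finset.univ.erase i₀ with hT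
  have hind := h.indepFun_finset {i₀} T (by simp [hT]) hX
  have h1 := lintegral_indepFun (measurable_pi_lambda _ fun i : ({i₀} : Finset ι) => hX i)
    (measurable_pi_lambda _ fun i : T => hX i) hind
    (f := fun p p' => A (p ⟨i₀, Finset.mem_singleton_self _⟩) *
        ∏ i : T, P (p ⟨i₀, Finset.mem_singleton_self _⟩) i (p' i)) (by
      refine Measurable.mul (hA.comp (g := A) ((measurable_pi_apply _).comp measurable_fst)) ?_
      refine Finset.measurable_prod _ fun i _ => ?_
      have hpi : Measurable fun a : (({i₀} : Finset ι) → C) × (T → C) =>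
          (a.1 ⟨i₀, Finset.mem_singleton_self _⟩, a.2 i) :=
        ((measurable_pi_apply _).comp measurable_fst).prodMk
          ((measurable_pi_apply _).comp measurable_snd)
      exact (hP i).comp hpi)
  have h2 (ω ω' : Ω) : ∏ i : T, P (X i₀ ω) i (X i ω') = ∏ i ∈ T, P (X i₀ ω) i (X i ω') :=
    Finset.prod_coe_sort T fun i => P (X i₀ ω) i (X i ω')
  simp only [h2] at h1
  rw [h1]
  refine lintegral_congr fun ω => ?_
  have hm (i : ι) : Measurable fun c => P (X i₀ ω) i c :=
    (hP i).comp (measurable_const.prodMk measurable_id)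
  have hm' (i : ι) : Measurable fun ω' => P (X i₀ ω) i (X i ω') := (hm i).comp (hX i)
  rw [lintegral_const_mul _ (Finset.measurable_prod _ fun i _ => hm' i),
    lintegral_prod_eq_prod_lintegral_of_indepFun T (fun i ω' => P (X i₀ ω) i (X i ω'))
      (h.comp (fun i c => P (X i₀ ω) i c) hm) hm']

/-! ### Comparison of path gains -/

namespace Network

variable {W : Type*} (net : Network W)

/-- The distance at which a base station of class `i` has the same path gain as a LOS base station
of tier `w` at distance `t`. -/
def radius (w : W) (i : W × Sight) (t : ℝ) : ℝ :=
  (net.C i.1 i.2 / net.C w Sight.los) ^ (1 / net.α i.1 i.2)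
    * t ^ (net.α w Sight.los / net.α i.1 i.2)

lemma measurable_radius (w : W) (i : W × Sight) : Measurable (net.radius w i) := by
  unfold radius
  fun_prop

lemma radius_nonneg (w : W) (i : W × Sight) {t : ℝ} (ht : 0 ≤ t) : 0 ≤ net.radius w i t := by
  have := net.C_pos i.1 i.2
  have := net.C_pos w Sight.los
  unfold radius; positivity

lemma radius_self (w : W) (t : ℝ) : net.radius w (w, Sight.los) t = t := by
  have := net.C_pos w Sight.los
  have := net.α_pos w Sight.los
  simp [radius, this.ne', (net.C_pos w Sight.los).ne']

/-- Raising to the power `α` of class `i` turns the comparison with `radius` into one of `C / r^α`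
terms. -/
lemma pathGain_lt_iff (w : W) (i : W × Sight) {r t : ℝ} (hr : 0 < r) (ht : 0 < t) :
    net.pathGain i.1 i.2 r < net.pathGain w Sight.los t ↔ net.radius w i t < r := by
  have hC := net.C_pos i.1 i.2
  have hCw := net.C_pos w Sight.los
  have hα := net.α_pos i.1 i.2
  rw [← Real.rpow_lt_rpow_iff (net.radius_nonneg w i ht.le) hr.le hα]
  have h1 : net.radius w i t ^ net.α i.1 i.2
      = net.C i.1 i.2 / net.C w Sight.los * t ^ net.α w Sight.los := by
    rw [radius, Real.mul_rpow (by positivity) (by positivity), ← Real.rpow_mul (by positivity),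
      ← Real.rpow_mul ht.le, one_div_mul_cancel hα.ne', div_mul_cancel₀ _ hα.ne', Real.rpow_one]
  have h2 := Real.rpow_pos_of_pos hr (net.α i.1 i.2)
  have h3 := Real.rpow_pos_of_pos ht (net.α w Sight.los)
  rw [h1, pathGain, pathGain, Real.rpow_neg hr.le, Real.rpow_neg ht.le, ← div_eq_mul_inv,
    ← div_eq_mul_inv, div_lt_div_iff₀ h2 h3, div_mul_eq_mul_div, div_lt_iff₀ hCw,
    mul_comm (net.C w Sight.los)]

/-- The LOS intercept and exponent of tier `j` cancel in the composition, so the two-step radius of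
the formula is the direct one. -/
lemma ψ_losRadius_eq (w j : W) {t : ℝ} (ht : 0 ≤ t) :
    net.ψ j (net.losRadius w j t) = net.radius w (j, Sight.nlos) t := by
  have h1 := net.C_pos j Sight.los
  have h2 := net.C_pos j Sight.nlos
  have h3 := net.C_pos w Sight.los
  have h4 := net.α_pos j Sight.los
  have h5 := net.α_pos j Sight.nlos
  simp only [ψ, losRadius, radius]
  rw [Real.mul_rpow (by positivity) (by positivity), ← Real.rpow_mul (by positivity),
    ← Real.rpow_mul ht, ← mul_assoc]
  congr 1
  · rw [show 1 / net.α j Sight.los * (net.α j Sight.los / net.α j Sight.nlos)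
      = 1 / net.α j Sight.nlos by field_simp, ← Real.mul_rpow (by positivity) (by positivity)]
    congr 1
    field_simp
  · congr 1
    field_simp

end Network

/-! ### The association event in terms of the configurations -/

namespace Field

variable {W Ω : Type*} (net : Network W) (F : Field W Ω)

/-- The configuration of the base stations of class `i`. -/
def config (i : W × Sight) (ω : Ω) : ℕ∞ × (ℕ → Plane) := (F.N i ω, fun l => F.X i l ω)

/-- The realizations in which no base station is at the origin, and in which the LOS base stations
of tier `w` are locally finite with distinct distances. -/
structure Regular (w : W) (ω : Ω) : Prop where
  dist_pos : ∀ q, F.Present q ω → 0 < F.dist q ω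
  injective : ∀ l l' : ℕ, l ≠ l' → F.Present ((w, Sight.los), l) ω →
    F.Present ((w, Sight.los), l') ω →
    F.dist ((w, Sight.los), l) ω ≠ F.dist ((w, Sight.los), l') ω
  finite : ∀ b : ℝ, {l : ℕ | F.Present ((w, Sight.los), l) ω ∧
    F.dist ((w, Sight.los), l) ω < b}.Finite

variable {net F}

lemma Serves.eq {q q' : (W × Sight) × ℕ} {ω : Ω} (h : F.Serves net q ω) (h' : F.Serves net q' ω) :
    q = q' := by
  by_contra hne
  exact lt_asymm (h.2 q' (Ne.symm hne) h'.1) (h'.2 q hne h.1)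

lemma Serves.servingBS_eq {w : W} {l : ℕ} {ω : Ω} (h : F.Serves net ((w, Sight.los), l) ω) :
    F.servingBS net w ω = ((w, Sight.los), l) := by
  have : {l | F.Serves net ((w, Sight.los), l) ω} = {l} := by
    ext l'
    constructor
    · intro h'
      exact (Prod.ext_iff.1 (Serves.eq h' h)).2
    · rintro rfl; exact h
  rw [servingBS, this, csInf_singleton]

lemma Serves.servingDist_eq {w : W} {l : ℕ} {ω : Ω} (h : F.Serves net ((w, Sight.los), l) ω) :
    F.servingDist net w ω = F.dist ((w, Sight.los), l) ω := by
  rw [servingDist, h.servingBS_eq]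

lemma Serves.nearest_eq {w : W} {l : ℕ} {ω : Ω} (hω : F.Regular w ω)
    (h : F.Serves net ((w, Sight.los), l) ω) :
    nearest (F.config (w, Sight.los) ω) = ENNReal.ofReal (F.dist ((w, Sight.los), l) ω) := by
  apply le_antisymm
  · refine iInf_le_of_le l ?_
    rw [if_pos (show (l : ℕ∞) < (F.config (w, Sight.los) ω).1 from h.1)]
    exact le_rfl
  · rw [ofReal_le_nearest_iff]
    intro l' hl'
    by_cases hll : l' = l
    · rw [hll]; exact le_rfl
    · have h1 := h.2 ((w, Sight.los), l') (fun h => hll (Prod.ext_iff.1 h).2) hl'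
      rw [net.pathGain_lt_iff w (w, Sight.los) (hω.dist_pos ((w, Sight.los), l') hl') (hω.dist_pos _ h.1),
        net.radius_self] at h1
      exact h1.le

/-- Within the class `(w, los)`, the largest gain is the smallest distance: local finiteness makes
the minimum attained, injectivity makes it strict. The discs of the other classes are closed because
a tie in path gain prevents service. -/
lemma mem_servedLOS_iff {w : W} {ω : Ω} (hω : F.Regular w ω) :
    ω ∈ F.servedLOS net w ↔ nearest (F.config (w, Sight.los) ω) ≠ ∞ ∧
      ∀ i ≠ (w, Sight.los), ∀ l : ℕ, (l : ℕ∞) < F.N i ω →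
        ‖F.X i l ω‖ ∉ Iic (net.radius w i (nearest (F.config (w, Sight.los) ω)).toReal) := by
  constructor
  · rintro ⟨l, hl⟩
    rw [hl.nearest_eq hω]
    refine ⟨ENNReal.ofReal_ne_top, fun i hi l' hl' => ?_⟩
    have h0 := hω.dist_pos _ hl.1
    rw [ENNReal.toReal_ofReal h0.le, mem_Iic, not_le]
    exact (net.pathGain_lt_iff w i (hω.dist_pos (i, l') hl') h0).1
      (hl.2 (i, l') (fun h => hi (Prod.ext_iff.1 h).1) hl')
  · rintro ⟨hfin, hother⟩
    set R := nearest (F.config (w, Sight.los) ω) with hR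
    obtain ⟨l₀, h₀⟩ : ∃ l₀ : ℕ, F.Present ((w, Sight.los), l₀) ω := by
      by_contra hne
      push Not at hne
      refine hfin (top_le_iff.1 (le_iInf fun l => ?_))
      rw [if_neg (show ¬ (l : ℕ∞) < (F.config (w, Sight.los) ω).1 from hne l)]
    obtain ⟨l, hl, hmin⟩ := Set.exists_min_image _ (fun l => F.dist ((w, Sight.los), l) ω)
      (hω.finite (F.dist ((w, Sight.los), l₀) ω + 1)) ⟨l₀, h₀, lt_add_one _⟩
    have hmin' (l' : ℕ) (hl' : F.Present ((w, Sight.los), l') ω) :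
        F.dist ((w, Sight.los), l) ω ≤ F.dist ((w, Sight.los), l') ω := by
      rcases lt_or_ge (F.dist ((w, Sight.los), l') ω) (F.dist ((w, Sight.los), l₀) ω + 1) with h | h
      · exact hmin l' ⟨hl', h⟩
      · exact hl.2.le.trans h
    have h0 := hω.dist_pos _ hl.1
    have hRl : R = ENNReal.ofReal (F.dist ((w, Sight.los), l) ω) := by
      apply le_antisymm
      · refine iInf_le_of_le l ?_
        rw [if_pos (show (l : ℕ∞) < (F.config (w, Sight.los) ω).1 from hl.1)]
        exact le_rfl
      · exact ofReal_le_nearest_iff.2 hmin'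
    refine ⟨l, hl.1, ?_⟩
    rintro ⟨i, l'⟩ hne hl'
    refine (net.pathGain_lt_iff w i (hω.dist_pos _ hl') h0).2 ?_
    by_cases hi : i = (w, Sight.los)
    · subst hi
      rw [net.radius_self]
      have hll : l ≠ l' := fun h => hne (by rw [h])
      exact lt_of_le_of_ne (hmin' l' hl') (hω.injective l l' hll hl.1 hl')
    · have := hother i hi l' hl'
      rw [hRl, ENNReal.toReal_ofReal h0.le, mem_Iic, not_le] at this
      exact this

-- The exclusion of each other class is moved into its weight by `kill`. What is left is one factor
-- per class, coupled only through the nearest distance of the class `(w, los)`.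
open Classical in
lemma indicator_servedLOS [Fintype W] {w : W} {ω : Ω} (hω : F.Regular w ω) (f : ℝ → ℝ≥0∞)
    (v : W × Sight → ℝ → ℝ≥0∞) :
    (F.servedLOS net w).indicator (fun ω => f (F.servingDist net w ω) *
        ∏ i, eneg (psum (fun z => v i ‖z‖) (F.config i ω))) ω
      = {p : ℕ∞ × (ℕ → Plane) | nearest p ≠ ∞}.indicator (fun p => f (nearest p).toReal
          * eneg (psum (fun z => v (w, Sight.los) ‖z‖) p)) (F.config (w, Sight.los) ω)
        * ∏ i ∈ Finset.univ.erase (w, Sight.los),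
            eneg (psum (fun z => kill
              (Iic (net.radius w i (nearest (F.config (w, Sight.los) ω)).toReal)) (v i) ‖z‖)
              (F.config i ω)) := by
  have hk (i : W × Sight) (t : ℝ) := eneg_psum_kill (norm ⁻¹' (Iic t)) (fun z : Plane => v i ‖z‖)
    (F.config i ω)
  simp only [show ∀ i t, kill (norm ⁻¹' (Iic t)) (fun z : Plane => v i ‖z‖)
    = fun z => kill (Iic t) (v i) ‖z‖ from fun _ _ => rfl] at hk
  by_cases hs : ω ∈ F.servedLOS net w
  · have h1 := (mem_servedLOS_iff hω).1 hs
    obtain ⟨l, hl⟩ := hs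
    rw [indicator_of_mem (show ω ∈ F.servedLOS net w from ⟨l, hl⟩),
      indicator_of_mem (show _ ∈ {p : ℕ∞ × (ℕ → Plane) | nearest p ≠ ∞} from h1.1),
      ← Finset.mul_prod_erase Finset.univ _ (Finset.mem_univ (w, Sight.los)), mul_assoc]
    have h2 : F.servingDist net w ω = (nearest (F.config (w, Sight.los) ω)).toReal := by
      rw [hl.nearest_eq hω, ENNReal.toReal_ofReal (hω.dist_pos _ hl.1).le, hl.servingDist_eq]
    rw [h2]
    congr 2
    refine Finset.prod_congr rfl fun i hi => ?_
    rw [hk, indicator_of_mem]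
    exact h1.2 i (Finset.ne_of_mem_erase hi)
  · rw [indicator_of_notMem hs]
    by_cases hR : nearest (F.config (w, Sight.los) ω) = ∞
    · rw [indicator_of_notMem (by simpa using hR), zero_mul]
    · have h1 : ¬ _ := fun h => hs ((mem_servedLOS_iff hω).2 ⟨hR, h⟩)
      push Not at h1
      obtain ⟨i, hi, l, hl, hmem⟩ := h1
      rw [Finset.prod_eq_zero (Finset.mem_erase.2 ⟨hi, Finset.mem_univ i⟩), mul_zero]
      rw [hk, indicator_of_notMem]
      intro h
      exact h l hl hmem

end Field

/-! ### Integration over the association event -/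

namespace IsModel

variable {W Ω : Type*} [MeasurableSpace Ω] {μ : Measure Ω} {net : Network W} {F : Field W Ω}

lemma measurable_config (h : IsModel μ net F) (i : W × Sight) : Measurable (F.config i) :=
  (h.poisson i).measurable_config

lemma ae_regular [Finite W] [IsProbabilityMeasure μ] (h : IsModel μ net F) (w : W) :
    ∀ᵐ ω ∂μ, F.Regular w ω := by
  have h1 : ∀ᵐ ω ∂μ, ∀ i : W × Sight, ∀ l : ℕ, (l : ℕ∞) < F.N i ω → 0 < ‖F.X i l ω‖ :=
    ae_all_iff.2 fun i => (h.poisson i).ae_norm_pos (net.isRadial_radial i.1 i.2)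
  filter_upwards [h1, (h.poisson (w, Sight.los)).ae_norm_injective (net.isRadial_radial _ _),
    (h.poisson (w, Sight.los)).ae_finite (net.isRadial_radial _ _)] with ω h1 h2 h3
  exact ⟨fun q hq => h1 q.1 q.2 hq, h2, h3⟩

-- Given the configuration of `(w, los)`, the other classes contribute killed Laplace functionals
-- depending on its nearest distance alone. `lintegral_nearest` then integrates over that distance.
open Classical in
lemma lintegral_servedLOS_prod [Fintype W] [IsProbabilityMeasure μ] (h : IsModel μ net F) (w : W)
    (hmeas : MeasurableSet (F.servedLOS net w))
    {f : ℝ → ℝ≥0∞} (hf : Measurable f) {v : W × Sight → ℝ → ℝ≥0∞} (hv : ∀ i, Measurable (v i)) :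
    ∫⁻ ω in F.servedLOS net w, f (F.servingDist net w ω) *
        ∏ i, eneg (psum (fun z => v i ‖z‖) (F.config i ω)) ∂μ
      = ∫⁻ t, f t * eneg (v (w, Sight.los) t) *
          ∏ i, eneg (∫⁻ r, (1 - eneg (kill (Iic (net.radius w i t)) (v i) r))
            ∂(net.radial i.1 i.2)) ∂(net.radial w Sight.los) := by
  set w₀ : W × Sight := (w, Sight.los) with hw₀
  set T : Finset (W × Sight) := Finset.univ.erase w₀ with hT
  set H : ℝ → ℝ≥0∞ := fun t => ∏ i ∈ T,
    eneg (∫⁻ r, (1 - eneg (kill (Iic (net.radius w i t)) (v i) r)) ∂(net.radial i.1 i.2)) with hH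
  have hkill (i : W × Sight) :
      Measurable (Function.uncurry fun (t : ℝ) (r : ℝ) => kill (Iic (net.radius w i t)) (v i) r) := by
    refine Measurable.ite (measurableSet_le measurable_snd
      ((net.measurable_radius w i).comp measurable_fst)) measurable_const ((hv i).comp measurable_snd)
  have hsf (i : W × Sight) : SFinite (net.radial i.1 i.2) := by
    unfold Network.radial; infer_instance
  have hHm : Measurable H := by
    refine Finset.measurable_prod _ fun i _ => measurable_eneg.comp ?_
    exact (measurable_const.sub (measurable_eneg.comp (hkill i))).lintegral_prod_right'
  rw [← lintegral_indicator hmeas]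
  set A : (ℕ∞ × (ℕ → Plane)) → ℝ≥0∞ := {p : ℕ∞ × (ℕ → Plane) | nearest p ≠ ∞}.indicator
    (fun p => f (nearest p).toReal * eneg (psum (fun z => v w₀ ‖z‖) p)) with hA
  have hAm : Measurable A := by
    refine Measurable.indicator ?_ (measurable_nearest (measurableSet_singleton _).compl)
    exact (hf.comp measurable_nearest.ennreal_toReal).mul
      (measurable_eneg.comp (measurable_psum ((hv w₀).comp measurable_norm)))
  set P : (ℕ∞ × (ℕ → Plane)) → (W × Sight) → (ℕ∞ × (ℕ → Plane)) → ℝ≥0∞ := fun p i p' =>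
    eneg (psum (fun z => kill (Iic (net.radius w i (nearest p).toReal)) (v i) ‖z‖) p') with hP
  have hPm (i : W × Sight) : Measurable fun q : (ℕ∞ × (ℕ → Plane)) × (ℕ∞ × (ℕ → Plane)) =>
      P q.1 i q.2 := by
    refine measurable_eneg.comp ?_
    refine (measurable_psum_prod (T := ℝ) (u := fun t z => kill (Iic (net.radius w i t)) (v i) ‖z‖)
      ((hkill i).comp (measurable_fst.prodMk (measurable_norm.comp measurable_snd)))).comp
      ((measurable_nearest.ennreal_toReal.comp measurable_fst).prodMk measurable_snd)
  calc _ = ∫⁻ ω, A (F.config w₀ ω) * ∏ i ∈ T, P (F.config w₀ ω) i (F.config i ω) ∂μ := by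
        refine lintegral_congr_ae ?_
        filter_upwards [h.ae_regular w] with ω hω
        exact Field.indicator_servedLOS hω f v
    _ = ∫⁻ ω, A (F.config w₀ ω) * H (nearest (F.config w₀ ω)).toReal ∂μ := by
        rw [lintegral_iIndepFun_erase (fun i => h.measurable_config i) h.indep_processes w₀ hAm hPm]
        refine lintegral_congr fun ω => ?_
        congr 1
        refine Finset.prod_congr rfl fun i _ => ?_
        exact (h.poisson i).lintegral_eneg_kill measurableSet_Iic (hv i)
    _ = ∫⁻ ω in {ω | nearest (F.config w₀ ω) ≠ ∞},
          (f (nearest (F.config w₀ ω)).toReal * H (nearest (F.config w₀ ω)).toReal)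
            * eneg (psum (fun z => v w₀ ‖z‖) (F.config w₀ ω)) ∂μ := by
        have hfin : MeasurableSet {ω | nearest (F.config w₀ ω) ≠ ∞} :=
          (measurable_nearest.comp (h.measurable_config w₀)) (measurableSet_singleton _).compl
        rw [← lintegral_indicator hfin]
        refine lintegral_congr fun ω => ?_
        by_cases hω : nearest (F.config w₀ ω) = ∞
        · simp [hA, hω]
        · simp only [hA]
          rw [indicator_of_mem (by exact hω), indicator_of_mem (by exact hω)]
          ring
    _ = _ := by
        refine ((h.poisson w₀).lintegral_nearest (net.isRadial_radial _ _) (hv w₀)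
          (hf.mul hHm)).trans ?_
        refine lintegral_congr fun t => ?_
        rw [← Finset.mul_prod_erase Finset.univ _ (Finset.mem_univ w₀), ← hT]
        have h3 : ∫⁻ r, (1 - eneg (kill (Iio t) (v w₀) r)) ∂(net.radial w Sight.los)
            = ∫⁻ r, (1 - eneg (kill (Iic (net.radius w w₀ t)) (v w₀) r))
              ∂(net.radial w₀.1 w₀.2) := by
          rw [net.radius_self, lintegral_kill measurableSet_Iio, lintegral_kill measurableSet_Iic]
          -- The nearest point leaves an open void disc, the common formula a closed one; circles
          -- carry no intensity.
          have h4 : Iio t =ᵐ[net.radial w Sight.los] Iic t := by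
            have : NullSingletonClass (net.radial w Sight.los) :=
              ⟨fun t => (net.isRadial_radial w Sight.los).measure_singleton t⟩
            exact Iio_ae_eq_Iic
          rw [measure_congr h4, setLIntegral_congr h4.compl]
        rw [← h3]
        simp only [Pi.mul_apply, hH, Network.radial]
        ring

end IsModel

/-! ### Received power and its Laplace transform -/

/-- Independence gives the product over finite sets, and domination by `1` the limit. Taking
logarithms expresses the infinite product as the exponential of a sum over points. -/
lemma lintegral_eneg_tsum {Ω Q : Type*} [MeasurableSpace Ω] [Countable Q] {μ : Measure Ω}
    [IsProbabilityMeasure μ] {T : Q → Ω → ℝ≥0∞} (hT : ∀ q, Measurable (T q)) (h : iIndepFun T μ) :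
    ∫⁻ ω, eneg (∑' q, T q ω) ∂μ = eneg (∑' q, nlog (∫⁻ ω, eneg (T q ω) ∂μ)) := by
  have hle (q : Q) : ∫⁻ ω, eneg (T q ω) ∂μ ≤ 1 := by
    calc ∫⁻ ω, eneg (T q ω) ∂μ ≤ ∫⁻ _, 1 ∂μ := lintegral_mono fun ω => eneg_le_one _
      _ = 1 := by simp
  have hfin (s : Finset Q) : ∫⁻ ω, eneg (∑ q ∈ s, T q ω) ∂μ
      = eneg (∑ q ∈ s, nlog (∫⁻ ω, eneg (T q ω) ∂μ)) := by
    simp_rw [eneg_sum]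
    rw [lintegral_prod_eq_prod_lintegral_of_indepFun s (fun q ω => eneg (T q ω))
      (h.comp (fun _ => eneg) fun _ => measurable_eneg) (fun q => measurable_eneg.comp (hT q))]
    exact Finset.prod_congr rfl fun q _ => (eneg_nlog (hle q)).symm
  have h1 : Filter.Tendsto (fun s : Finset Q => ∫⁻ ω, eneg (∑ q ∈ s, T q ω) ∂μ) Filter.atTop
      (nhds (∫⁻ ω, eneg (∑' q, T q ω) ∂μ)) := by
    refine tendsto_lintegral_filter_of_dominated_convergence (fun _ => 1)
      (Filter.Eventually.of_forall fun s => ?_)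
      (Filter.Eventually.of_forall fun s => Filter.Eventually.of_forall fun ω => eneg_le_one _)
      (by simp) (Filter.Eventually.of_forall fun ω => ?_)
    · exact measurable_eneg.comp (Finset.measurable_sum _ fun q _ => hT q)
    · exact (continuous_eneg.tendsto _).comp ENNReal.summable.hasSum
  have h2 : Filter.Tendsto (fun s : Finset Q => eneg (∑ q ∈ s, nlog (∫⁻ ω, eneg (T q ω) ∂μ)))
      Filter.atTop (nhds (eneg (∑' q, nlog (∫⁻ ω, eneg (T q ω) ∂μ)))) :=
    (continuous_eneg.tendsto _).comp ENNReal.summable.hasSum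
  simp_rw [hfin] at h1
  exact tendsto_nhds_unique h1 h2

lemma measurable_random_index {Ω : Type*} [MeasurableSpace Ω] {g : ℕ → Ω → ℝ}
    (hg : ∀ n, Measurable (g n)) {n : Ω → ℕ} (hn : Measurable n) :
    Measurable fun ω => g (n ω) ω := by
  have h : Measurable (fun q : ℕ × Ω => g q.1 q.2) := measurable_from_prod_countable_right hg
  exact h.comp (hn.prodMk measurable_id)

namespace Network

variable {W : Type*} (net : Network W)

lemma cr_mem (j : W) : net.cr j ∈ Icc (0 : ℝ) 1 := by
  have h := net.θr_mem j
  have hpi := Real.pi_pos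
  exact ⟨div_nonneg h.1 (by positivity), (div_le_one (by positivity)).2 h.2⟩

lemma ct_mem (j : W) : net.ct j ∈ Icc (0 : ℝ) 1 := by
  have h := net.θt_mem j
  have hpi := Real.pi_pos
  exact ⟨div_nonneg h.1 (by positivity), (div_le_one (by positivity)).2 h.2⟩

lemma b_nonneg (j : W) (k : Fin 4) : 0 ≤ net.b j k := by
  have h1 := net.cr_mem j
  have h2 := net.ct_mem j
  have h3 := sub_nonneg.2 h1.2
  have h4 := sub_nonneg.2 h2.2
  fin_cases k
  · exact mul_nonneg h1.1 h2.1
  · exact mul_nonneg h1.1 h4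
  · exact mul_nonneg h3 h2.1
  · exact mul_nonneg h3 h4

lemma sum_b (j : W) : ∑ k, net.b j k = 1 := by
  simp [b, Fin.sum_univ_four]
  ring

lemma a_nonneg (j : W) (k : Fin 4) : 0 ≤ net.a j k := by
  have h1 := net.Mr_pos j
  have h2 := net.Mt_pos j
  have h3 := net.mr_nonneg j
  have h4 := net.mt_nonneg j
  fin_cases k <;> simp [a] <;> positivity

instance (j : W) : IsProbabilityMeasure (net.gainLaw j) where
  measure_univ := by
    simp only [gainLaw, Measure.coe_finsetSum, Finset.sum_apply, Measure.smul_apply, measure_univ,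
      smul_eq_mul, mul_one]
    rw [← ENNReal.ofReal_sum_of_nonneg fun k _ => net.b_nonneg j k, sum_b, ENNReal.ofReal_one]

instance (j : W) : IsProbabilityMeasure (gammaMeasure (net.K j : ℝ) 1) :=
  isProbabilityMeasure_gammaMeasure (by exact_mod_cast net.K_pos j) one_pos

/-- Law of the marks of a base station of tier `j`. -/
def markLaw (j : W) : Measure (ℝ × ℝ) := (net.gainLaw j).prod (gammaMeasure (net.K j : ℝ) 1)

instance (j : W) : IsProbabilityMeasure (net.markLaw j) := by unfold markLaw; infer_instance

/-- Power received from a base station of class `i` at distance `r` with marks `m`. -/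
def power (i : W × Sight) (r : ℝ) (m : ℝ × ℝ) : ℝ≥0∞ :=
  ENNReal.ofReal (m.1 * net.pathGain i.1 i.2 r * (m.2 / net.K i.1))

lemma measurable_pathGain (j : W) (z : Sight) : Measurable (net.pathGain j z) := by
  unfold pathGain
  fun_prop

lemma measurable_power (i : W × Sight) : Measurable fun q : ℝ × (ℝ × ℝ) => net.power i q.1 q.2 := by
  have := net.measurable_pathGain i.1 i.2
  unfold power
  fun_prop

lemma power_ne_top (i : W × Sight) (r : ℝ) (m : ℝ × ℝ) : net.power i r m ≠ ∞ :=
  ENNReal.ofReal_ne_top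

/-- Laplace transform, at `c`, of the power received from a base station of class `i` at
distance `r`. -/
def powerLaplace (i : W × Sight) (c : ℝ≥0∞) (r : ℝ) : ℝ≥0∞ :=
  ∫⁻ m, eneg (c * net.power i r m) ∂(net.markLaw i.1)

lemma powerLaplace_le_one (i : W × Sight) (c : ℝ≥0∞) (r : ℝ) : net.powerLaplace i c r ≤ 1 := by
  calc net.powerLaplace i c r ≤ ∫⁻ _, 1 ∂(net.markLaw i.1) := lintegral_mono fun ω => eneg_le_one _
    _ = 1 := by simp

lemma measurable_powerLaplace_uncurry (i : W × Sight) :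
    Measurable fun q : ℝ≥0∞ × ℝ => net.powerLaplace i q.1 q.2 := by
  have h : Measurable fun q : (ℝ≥0∞ × ℝ) × (ℝ × ℝ) => eneg (q.1.1 * net.power i q.1.2 q.2) := by
    refine measurable_eneg.comp (Measurable.mul (by fun_prop) ?_)
    exact (net.measurable_power i).comp (f := fun q : (ℝ≥0∞ × ℝ) × (ℝ × ℝ) => (q.1.2, q.2))
      (by fun_prop)
  exact h.lintegral_prod_right'

lemma measurable_powerLaplace (i : W × Sight) (c : ℝ≥0∞) : Measurable (net.powerLaplace i c) :=
  (net.measurable_powerLaplace_uncurry i).comp (measurable_const.prodMk measurable_id)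

/-- For finite `c` the exponent is finite, so the integrand is positive everywhere. This permits
division by the factor of the serving station. -/
lemma powerLaplace_ne_zero (i : W × Sight) {c : ℝ≥0∞} (hc : c ≠ ∞) (r : ℝ) :
    net.powerLaplace i c r ≠ 0 := by
  have h : Measurable fun m => eneg (c * net.power i r m) := by
    refine measurable_eneg.comp (measurable_const.mul ?_)
    exact (net.measurable_power i).comp (measurable_const.prodMk measurable_id)
  intro h0
  rw [powerLaplace, lintegral_eq_zero_iff h] at h0
  obtain ⟨m, hm⟩ := h0.exists
  exact ENNReal.mul_ne_top hc (net.power_ne_top i r m) (eneg_eq_zero_iff.1 hm)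

end Network

/-! ### Measurability of the association -/

namespace Field

variable {W Ω : Type*} {net : Network W} {F : Field W Ω}

section Measurability

variable [MeasurableSpace Ω]

lemma measurableSet_present {F : Field W Ω} (hF : ∀ i, Measurable (F.config i))
    (q : (W × Sight) × ℕ) : MeasurableSet {ω | F.Present q ω} :=
  (measurable_fst.comp (hF q.1)) (MeasurableSet.of_discrete (s := Ioi (q.2 : ℕ∞)))

lemma measurable_dist (hF : ∀ i, Measurable (F.config i)) (q : (W × Sight) × ℕ) :
    Measurable (F.dist q) :=
  measurable_norm.comp ((measurable_pi_apply q.2).comp (measurable_snd.comp (hF q.1)))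

lemma measurableSet_serves [Countable W] (hF : ∀ i, Measurable (F.config i)) (q : (W × Sight) × ℕ) :
    MeasurableSet {ω | F.Serves net q ω} := by
  have h (q : (W × Sight) × ℕ) : Measurable fun ω => net.pathGain q.1.1 q.1.2 (F.dist q ω) :=
    (net.measurable_pathGain _ _).comp (measurable_dist hF q)
  have h1 : {ω | F.Serves net q ω} = {ω | F.Present q ω} ∩ ⋂ q' : (W × Sight) × ℕ,
      {ω | q' ≠ q → F.Present q' ω → net.pathGain q'.1.1 q'.1.2 (F.dist q' ω)
        < net.pathGain q.1.1 q.1.2 (F.dist q ω)} := by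
    ext ω
    simp only [Serves, mem_ofPred_eq, mem_inter_iff, mem_iInter]
  rw [h1]
  refine (measurableSet_present hF q).inter (MeasurableSet.iInter fun q' => ?_)
  by_cases hq : q' = q
  · simp [hq]
  · have h2 : {ω | q' ≠ q → F.Present q' ω → net.pathGain q'.1.1 q'.1.2 (F.dist q' ω)
        < net.pathGain q.1.1 q.1.2 (F.dist q ω)} = {ω | F.Present q' ω}ᶜ ∪
        {ω | net.pathGain q'.1.1 q'.1.2 (F.dist q' ω) < net.pathGain q.1.1 q.1.2 (F.dist q ω)} := by
      ext ω
      simp only [mem_ofPred_eq, mem_union, mem_compl_iff, ne_eq, hq, not_false_eq_true,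
        forall_const]
      exact imp_iff_not_or
    rw [h2]
    exact (measurableSet_present hF q').compl.union (measurableSet_lt (h q') (h q))

lemma measurableSet_servedLOS [Countable W] (hF : ∀ i, Measurable (F.config i)) (w : W) :
    MeasurableSet (F.servedLOS net w) := by
  have : F.servedLOS net w = ⋃ l : ℕ, {ω | F.Serves net ((w, Sight.los), l) ω} := by
    ext ω; simp [servedLOS]
  rw [this]
  exact MeasurableSet.iUnion fun l => measurableSet_serves hF _

lemma measurable_servingIndex [Countable W] (hF : ∀ i, Measurable (F.config i)) (w : W) :
    Measurable fun ω => sInf {l : ℕ | F.Serves net ((w, Sight.los), l) ω} := by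
  -- The value `0` is also the infimum of the empty set, hence ambiguous: only nonzero values are
  -- read off from `Serves`, and the fibre of `0` is the complement of the others.
  have h1 (n : ℕ) (hn : n ≠ 0) :
      MeasurableSet ((fun ω => sInf {l : ℕ | F.Serves net ((w, Sight.los), l) ω}) ⁻¹' {n}) := by
    have : (fun ω => sInf {l : ℕ | F.Serves net ((w, Sight.los), l) ω}) ⁻¹' {n}
        = {ω | F.Serves net ((w, Sight.los), n) ω} := by
      ext ω
      constructor
      · intro h
        have h' : sInf {l : ℕ | F.Serves net ((w, Sight.los), l) ω} = n := h
        have := Nat.sInf_mem (Nat.nonempty_of_pos_sInf (h' ▸ Nat.pos_of_ne_zero hn))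
        rw [h'] at this
        exact this
      · intro h
        exact (Prod.ext_iff.1 (Serves.servingBS_eq h)).2
    rw [this]
    exact measurableSet_serves hF _
  refine measurable_to_countable' fun n => ?_
  by_cases hn : n = 0
  · subst hn
    have : (fun ω => sInf {l : ℕ | F.Serves net ((w, Sight.los), l) ω}) ⁻¹' {0}
        = ⋂ n : ℕ, ((fun ω => sInf {l : ℕ | F.Serves net ((w, Sight.los), l) ω}) ⁻¹' {n + 1})ᶜ := by
      ext ω
      simp only [mem_preimage, mem_singleton_iff, mem_iInter, mem_compl_iff]
      constructor
      · intro h n; omega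
      · intro h
        by_contra h0
        obtain ⟨m, hm⟩ := Nat.exists_eq_succ_of_ne_zero h0
        exact h m hm
    rw [this]
    exact MeasurableSet.iInter fun n => (h1 _ (Nat.succ_ne_zero n)).compl
  · exact h1 n hn

lemma measurable_servingDist [Countable W] (hF : ∀ i, Measurable (F.config i)) (w : W) :
    Measurable (F.servingDist net w) :=
  measurable_random_index (fun l => measurable_dist hF ((w, Sight.los), l))
    (measurable_servingIndex (net := net) hF w)

lemma measurableSet_ne_servingBS [Countable W] (hF : ∀ i, Measurable (F.config i)) (w : W)
    (q : (W × Sight) × ℕ) : MeasurableSet {ω | q ≠ F.servingBS net w ω} := by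
  have : {ω | q ≠ F.servingBS net w ω}
      = (fun ω => sInf {l : ℕ | F.Serves net ((w, Sight.los), l) ω}) ⁻¹'
        {l | q ≠ ((w, Sight.los), l)} := rfl
  rw [this]
  exact measurable_servingIndex hF w
    (MeasurableSet.of_discrete (s := {l | q ≠ ((w, Sight.los), l)}))

end Measurability

end Field

/-! ### Averaging over the marks -/

namespace Field

variable {W Ω : Type*}

/-- The field of base stations on the space of configurations. -/
def canonical (W : Type*) : Field W (W × Sight → ℕ∞ × (ℕ → Plane)) where
  N i p := (p i).1
  X i l p := (p i).2 l
  G _ _ := 0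
  g _ _ := 0

lemma measurable_config_canonical (i : W × Sight) : Measurable ((canonical W).config i) :=
  measurable_pi_apply i

/-- The marks of base station `q`. -/
def mark (F : Field W Ω) (q : (W × Sight) × ℕ) (ω : Ω) : ℝ × ℝ := (F.G q ω, F.g q ω)

open Classical in
/-- The power received from the interferers of class `i`. -/
def classPower (net : Network W) (F : Field W Ω) (w : W) (i : W × Sight) (ω : Ω) : ℝ≥0∞ :=
  ∑' l : ℕ, if F.Present (i, l) ω ∧ (i, l) ≠ F.servingBS net w ω then
    net.power i (F.dist (i, l) ω) (F.mark (i, l) ω) else 0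

/-- The interference with the contribution of class `i` multiplied by `c i`. -/
def weighted [Fintype W] (net : Network W) (F : Field W Ω) (w : W) (c : W × Sight → ℝ≥0∞) (ω : Ω) :
    ℝ≥0∞ :=
  ∑ i, c i * F.classPower net w i ω

open Classical in
lemma weighted_eq_tsum [Fintype W] (net : Network W) (F : Field W Ω) (w : W)
    (c : W × Sight → ℝ≥0∞) (ω : Ω) :
    F.weighted net w c ω = ∑' q : (W × Sight) × ℕ,
      if F.Present q ω ∧ q ≠ F.servingBS net w ω then
        c q.1 * net.power q.1 (F.dist q ω) (F.mark q ω) else 0 := by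
  rw [ENNReal.tsum_prod', tsum_fintype, weighted]
  refine Finset.sum_congr rfl fun i _ => ?_
  rw [classPower, ← ENNReal.tsum_mul_left]
  refine tsum_congr fun l => ?_
  rw [mul_ite, mul_zero]

end Field

/-- `v` such that `e^{-v}` is the Laplace transform of the received power. -/
def Network.logLaplace {W : Type*} (net : Network W) (c : W × Sight → ℝ≥0∞) (i : W × Sight)
    (r : ℝ) : ℝ≥0∞ := nlog (net.powerLaplace i (c i) r)

lemma Network.eneg_logLaplace {W : Type*} (net : Network W) (c : W × Sight → ℝ≥0∞)
    (i : W × Sight) (r : ℝ) : eneg (net.logLaplace c i r) = net.powerLaplace i (c i) r :=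
  eneg_nlog (net.powerLaplace_le_one i (c i) r)

lemma Network.measurable_logLaplace {W : Type*} (net : Network W) (c : W × Sight → ℝ≥0∞)
    (i : W × Sight) : Measurable (net.logLaplace c i) :=
  measurable_nlog.comp (net.measurable_powerLaplace i (c i))

namespace IsModel

variable {W Ω : Type*} [MeasurableSpace Ω] {μ : Measure Ω} {net : Network W} {F : Field W Ω}

lemma measurable_mark (h : IsModel μ net F) (q : (W × Sight) × ℕ) : Measurable (F.mark q) :=
  (h.measurable_gain q).prodMk (h.measurable_fading q)

lemma map_mark [IsProbabilityMeasure μ] (h : IsModel μ net F) (q : (W × Sight) × ℕ) :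
    μ.map (F.mark q) = net.markLaw q.1.1 := by
  have h1 := (indepFun_iff_map_prod_eq_prod_map_map (h.measurable_gain q).aemeasurable
    (h.measurable_fading q).aemeasurable).1 (h.indep_gain_fading q)
  rw [h.law_gain, h.law_fading] at h1
  exact h1

lemma lintegral_mark [IsProbabilityMeasure μ] (h : IsModel μ net F) (q : (W × Sight) × ℕ)
    (c : ℝ≥0∞) (r : ℝ) :
    ∫⁻ ω, eneg (c * net.power q.1 r (F.mark q ω)) ∂μ = net.powerLaplace q.1 c r := by
  have hm : Measurable fun m => eneg (c * net.power q.1 r m) := by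
    refine measurable_eneg.comp (measurable_const.mul ?_)
    exact (net.measurable_power q.1).comp (measurable_const.prodMk measurable_id)
  rw [Network.powerLaplace, ← h.map_mark q, lintegral_map hm (h.measurable_mark q)]

lemma measurable_classPower [Countable W] (h : IsModel μ net F) (w : W) (i : W × Sight) :
    Measurable (F.classPower net w i) := by
  classical
  have hF := h.measurable_config
  unfold Field.classPower
  refine Measurable.tsum fun l => Measurable.ite
    ((Field.measurableSet_present hF _).inter (Field.measurableSet_ne_servingBS hF w _)) ?_
    measurable_const
  exact (net.measurable_power i).comp
    (f := fun ω => (F.dist (i, l) ω, F.mark (i, l) ω))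
    ((Field.measurable_dist hF _).prodMk (h.measurable_mark _))

-- On this event the serving station has the fixed index `l`, so the interferers are determined by
-- the positions. With the positions frozen, the marks are independent and each interferer
-- contributes its own Laplace transform.
open Classical in
lemma lintegral_serves [Fintype W] [IsProbabilityMeasure μ] (h : IsModel μ net F) (w : W) (l : ℕ)
    {f : ℝ → ℝ≥0∞} (hf : Measurable f) (c : W × Sight → ℝ≥0∞) :
    ∫⁻ ω in {ω | F.Serves net ((w, Sight.los), l) ω},
        f (F.servingDist net w ω) * eneg (F.weighted net w c ω) ∂μ
      = ∫⁻ ω in {ω | F.Serves net ((w, Sight.los), l) ω}, f (F.servingDist net w ω) *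
        eneg (∑' q : (W × Sight) × ℕ, if F.Present q ω ∧ q ≠ ((w, Sight.los), l) then
          net.logLaplace c q.1 (F.dist q ω) else 0) ∂μ := by
  set q₀ : (W × Sight) × ℕ := ((w, Sight.los), l) with hq₀
  have hF := h.measurable_config
  have hC := Field.measurable_config_canonical (W := W)
  have hS : MeasurableSet {ω | F.Serves net q₀ ω} := Field.measurableSet_serves hF q₀
  set P : Ω → (W × Sight → ℕ∞ × (ℕ → Plane)) := fun ω i => F.config i ω with hP
  set M : Ω → ((W × Sight) × ℕ → ℝ × ℝ) := fun ω q => F.mark q ω with hM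
  -- Presence, distance and service involve the positions only. The canonical field exhibits them as
  -- functions of `P ω`, as independence from the marks requires.
  set F₀ := Field.canonical W with hF₀
  set S₀ : Set (W × Sight → ℕ∞ × (ℕ → Plane)) := {p | F₀.Serves net q₀ p} with hS₀
  set t : (W × Sight → ℕ∞ × (ℕ → Plane)) → (W × Sight) × ℕ → ℝ × ℝ → ℝ≥0∞ := fun p q m =>
    if F₀.Present q p ∧ q ≠ q₀ then c q.1 * net.power q.1 (F₀.dist q p) m else 0 with ht
  have htm (q : (W × Sight) × ℕ) :
      Measurable fun z : (W × Sight → ℕ∞ × (ℕ → Plane)) × (ℝ × ℝ) => t z.1 q z.2 := by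
    have h1 : MeasurableSet {p | F₀.Present q p ∧ q ≠ q₀} :=
      (Field.measurableSet_present hC q).inter (MeasurableSet.const _)
    refine Measurable.ite (measurable_fst h1) (measurable_const.mul ?_) measurable_const
    exact (net.measurable_power q.1).comp
      (f := fun z : (W × Sight → ℕ∞ × (ℕ → Plane)) × (ℝ × ℝ) => (F₀.dist q z.1, z.2))
      (((Field.measurable_dist hC q).comp measurable_fst).prodMk measurable_snd)
  have hPm : Measurable P := measurable_pi_lambda _ hF
  have hMm : Measurable M := measurable_pi_lambda _ h.measurable_mark
  rw [← lintegral_indicator hS, ← lintegral_indicator hS]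
  set A : (W × Sight → ℕ∞ × (ℕ → Plane)) → ℝ≥0∞ := S₀.indicator fun p => f (F₀.dist q₀ p) with hA
  have hAm : Measurable A :=
    (hf.comp (Field.measurable_dist hC q₀)).indicator (Field.measurableSet_serves hC q₀)
  calc _ = ∫⁻ ω, A (P ω) * eneg (∑' q, t (P ω) q (M ω q)) ∂μ := by
        refine lintegral_congr fun ω => ?_
        by_cases hω : F.Serves net q₀ ω
        · rw [indicator_of_mem (by exact hω), hA, indicator_of_mem (show P ω ∈ S₀ from hω),
            Field.weighted_eq_tsum, hω.servingDist_eq, hω.servingBS_eq]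
          rfl
        · rw [indicator_of_notMem (by exact hω), hA, indicator_of_notMem (show P ω ∉ S₀ from hω),
            zero_mul]
    _ = ∫⁻ ω, ∫⁻ ω', A (P ω) * eneg (∑' q, t (P ω) q (M ω' q)) ∂μ ∂μ := by
        refine lintegral_indepFun hPm hMm h.indep_processes_marks
          (f := fun p m => A p * eneg (∑' q, t p q (m q))) ?_
        refine (hAm.comp measurable_fst).mul (measurable_eneg.comp (Measurable.tsum fun q => ?_))
        exact (htm q).comp (f := fun z : _ × ((W × Sight) × ℕ → ℝ × ℝ) => (z.1, z.2 q))
          (measurable_fst.prodMk ((measurable_pi_apply q).comp measurable_snd))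
    _ = ∫⁻ ω, A (P ω) * eneg (∑' q : (W × Sight) × ℕ, if F.Present q ω ∧ q ≠ q₀ then
          net.logLaplace c q.1 (F.dist q ω) else 0) ∂μ := by
        refine lintegral_congr fun ω => ?_
        have htm' (q : (W × Sight) × ℕ) : Measurable fun m => t (P ω) q m :=
          (htm q).comp (measurable_const.prodMk measurable_id)
        have htm'' (q : (W × Sight) × ℕ) : Measurable fun ω' => t (P ω) q (M ω' q) :=
          (htm' q).comp (h.measurable_mark q)
        rw [lintegral_const_mul (f := fun ω' => eneg (∑' q, t (P ω) q (M ω' q))) _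
            (measurable_eneg.comp (Measurable.tsum htm'')),
          lintegral_eneg_tsum htm'' (h.indep_marks.comp (fun q m => t (P ω) q m) htm')]
        congr 3
        funext q
        by_cases hq : F.Present q ω ∧ q ≠ q₀
        · have h1 (ω' : Ω) : t (P ω) q (M ω' q) = c q.1 * net.power q.1 (F.dist q ω) (F.mark q ω') :=
            if_pos hq
          simp_rw [h1]
          rw [if_pos hq, h.lintegral_mark]
          rfl
        · have h1 (ω' : Ω) : t (P ω) q (M ω' q) = 0 := if_neg hq
          simp_rw [h1]
          rw [if_neg hq]
          -- An absent or excluded station has transform `1`, whose negative logarithm is `0`.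
          simp [nlog]
    _ = _ := by
        refine lintegral_congr fun ω => ?_
        by_cases hω : F.Serves net q₀ ω
        · rw [indicator_of_mem (by exact hω), hA, indicator_of_mem (show P ω ∈ S₀ from hω),
            hω.servingDist_eq]
          rfl
        · rw [indicator_of_notMem (by exact hω), hA, indicator_of_notMem (show P ω ∉ S₀ from hω),
            zero_mul]

/-- The event is split by the index of the serving station. Its term is then added to the sum and
divided out again, so that each class carries a sum over all its points. -/
lemma lintegral_servedLOS_weighted_eq_prod [Fintype W] [IsProbabilityMeasure μ]
    (h : IsModel μ net F) (w : W) {f : ℝ → ℝ≥0∞} (hf : Measurable f) {c : W × Sight → ℝ≥0∞}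
    (hc : ∀ i, c i ≠ ∞) :
    ∫⁻ ω in F.servedLOS net w, f (F.servingDist net w ω) * eneg (F.weighted net w c ω) ∂μ
      = ∫⁻ ω in F.servedLOS net w, (f (F.servingDist net w ω) *
          (net.powerLaplace (w, Sight.los) (c (w, Sight.los)) (F.servingDist net w ω))⁻¹) *
        ∏ i, eneg (psum (fun z => net.logLaplace c i ‖z‖) (F.config i ω)) ∂μ := by
  classical
  have hF := h.measurable_config
  have hU : F.servedLOS net w = ⋃ l : ℕ, {ω | F.Serves net ((w, Sight.los), l) ω} := by
    ext ω; simp [Field.servedLOS]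
  have hS (l : ℕ) : MeasurableSet {ω | F.Serves net ((w, Sight.los), l) ω} :=
    Field.measurableSet_serves hF _
  have hdisj : Pairwise fun l l' : ℕ => Disjoint {ω | F.Serves net ((w, Sight.los), l) ω}
      {ω | F.Serves net ((w, Sight.los), l') ω} := fun l l' hll =>
    disjoint_left.2 fun ω h1 h2 => hll (Prod.ext_iff.1 (Field.Serves.eq h1 h2)).2
  rw [hU, lintegral_iUnion hS hdisj, lintegral_iUnion hS hdisj]
  refine tsum_congr fun l => ?_
  rw [h.lintegral_serves w l hf c]
  refine setLIntegral_congr_fun (hS l) fun ω hω => ?_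
  have hω' : F.Serves net ((w, Sight.los), l) ω := hω
  set q₀ : (W × Sight) × ℕ := ((w, Sight.los), l) with hq₀
  rw [hω'.servingDist_eq, mul_assoc]
  congr 1
  have h1 : ∏ i, eneg (psum (fun z => net.logLaplace c i ‖z‖) (F.config i ω))
      = eneg (∑' q : (W × Sight) × ℕ,
          if F.Present q ω then net.logLaplace c q.1 (F.dist q ω) else 0) := by
    rw [ENNReal.tsum_prod', tsum_fintype, eneg_sum]
    refine Finset.prod_congr rfl fun i _ => congrArg eneg (tsum_congr fun l => ?_)
    by_cases hl : F.Present (i, l) ω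
    · rw [if_pos hl, if_pos (by exact hl)]
      rfl
    · rw [if_neg hl, if_neg (by exact hl)]
  -- The serving term is split off the full sum; its exponential cancels against the inverse.
  rw [h1, ENNReal.tsum_eq_add_tsum_ite (f := fun q : (W × Sight) × ℕ =>
    if F.Present q ω then net.logLaplace c q.1 (F.dist q ω) else 0) q₀, if_pos hω'.1, eneg_add, Network.eneg_logLaplace,
    ← mul_assoc, ENNReal.inv_mul_cancel (net.powerLaplace_ne_zero _ (hc _) _)
      (ne_top_of_le_ne_top ENNReal.one_ne_top (net.powerLaplace_le_one _ _ _)), one_mul]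
  congr 2
  funext q
  by_cases hq : q = q₀
  · simp [hq]
  · simp [hq]

end IsModel

/-! ### Constant coefficients -/

/-- The Laplace transform of the weighted interference given the serving distance `t`. -/
def Network.condLaplace {W : Type*} [Fintype W] (net : Network W) (w : W)
    (c : W × Sight → ℝ≥0∞) (t : ℝ) : ℝ≥0∞ :=
  ∏ i, eneg (∫⁻ r in Ioi (net.radius w i t), (1 - net.powerLaplace i (c i) r)
    ∂(net.radial i.1 i.2))

instance {W : Type*} (net : Network W) (j : W) (z : Sight) : SFinite (net.radial j z) := by
  unfold Network.radial; infer_instance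

lemma Network.measurable_condLaplace {W : Type*} [Fintype W] (net : Network W) (w : W)
    {c : ℝ → W × Sight → ℝ≥0∞} (hc : Measurable c) :
    Measurable fun t => net.condLaplace w (c t) t := by
  refine Finset.measurable_prod _ fun i _ => measurable_eneg.comp ?_
  have h1 : Measurable fun q : ℝ × ℝ =>
      {q : ℝ × ℝ | net.radius w i q.1 < q.2}.indicator
        (fun q => 1 - net.powerLaplace i (c q.1 i) q.2) q := by
    refine Measurable.indicator (measurable_const.sub ?_)
      (measurableSet_lt ((net.measurable_radius w i).comp measurable_fst) measurable_snd)
    exact (net.measurable_powerLaplace_uncurry i).comp (f := fun q : ℝ × ℝ => (c q.1 i, q.2))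
      (((measurable_pi_apply i).comp (hc.comp measurable_fst)).prodMk measurable_snd)
  have h2 := h1.lintegral_prod_right' (ν := net.radial i.1 i.2)
  convert h2 using 2 with t
  rw [← lintegral_indicator measurableSet_Ioi]
  rfl

namespace IsModel

variable {W Ω : Type*} [Fintype W] [MeasurableSpace Ω] {μ : Measure Ω} [IsProbabilityMeasure μ]
  {net : Network W} {F : Field W Ω}

/-- The factor `e^{-v(t)}` from the nearest point cancels the inverse of the serving factor. Each
killed exponent splits into the intensity of the disc, a void probability, and the integral outside
it, a factor of `condLaplace`. -/
lemma lintegral_servedLOS_weighted (h : IsModel μ net F) (w : W) {f : ℝ → ℝ≥0∞}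
    (hf : Measurable f) {c : W × Sight → ℝ≥0∞} (hc : ∀ i, c i ≠ ∞) :
    ∫⁻ ω in F.servedLOS net w, f (F.servingDist net w ω) * eneg (F.weighted net w c ω) ∂μ
      = ∫⁻ t, f t * net.condLaplace w c t * ∏ i, eneg (net.radial i.1 i.2 (Iic (net.radius w i t)))
          ∂(net.radial w Sight.los) := by
  have hpl := net.measurable_powerLaplace (w, Sight.los) (c (w, Sight.los))
  rw [h.lintegral_servedLOS_weighted_eq_prod w hf hc, h.lintegral_servedLOS_prod w
    (Field.measurableSet_servedLOS h.measurable_config w)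
    (f := fun t => f t * (net.powerLaplace (w, Sight.los) (c (w, Sight.los)) t)⁻¹)
    (hf.mul hpl.inv) (net.measurable_logLaplace c)]
  refine lintegral_congr fun t => ?_
  rw [Network.eneg_logLaplace, mul_assoc (f t), ENNReal.inv_mul_cancel
    (net.powerLaplace_ne_zero _ (hc _) _)
    (ne_top_of_le_ne_top ENNReal.one_ne_top (net.powerLaplace_le_one _ _ _)), mul_one, mul_assoc,
    Network.condLaplace, ← Finset.prod_mul_distrib]
  congr 1
  refine Finset.prod_congr rfl fun i _ => ?_
  rw [lintegral_kill measurableSet_Iic, eneg_add, mul_comm, compl_Iic]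
  simp_rw [Network.eneg_logLaplace]

/-- The void probabilities do not involve `c`. At `c = 0` the formula describes the law of the
serving distance; tested against `f * condLaplace`, it reproduces the right-hand side for general
`c`. -/
lemma lintegral_weighted_eq_condLaplace (h : IsModel μ net F) (w : W) {f : ℝ → ℝ≥0∞}
    (hf : Measurable f) {c : W × Sight → ℝ≥0∞} (hc : ∀ i, c i ≠ ∞) :
    ∫⁻ ω in F.servedLOS net w, f (F.servingDist net w ω) * eneg (F.weighted net w c ω) ∂μ
      = ∫⁻ ω in F.servedLOS net w, f (F.servingDist net w ω) *
          net.condLaplace w c (F.servingDist net w ω) ∂μ := by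
  have hL : Measurable (net.condLaplace w c) := net.measurable_condLaplace w measurable_const
  have h0 := h.lintegral_servedLOS_weighted w (hf.mul hL) (c := 0) (by simp)
  have h1 (ω : Ω) : F.weighted net w 0 ω = 0 := by simp [Field.weighted]
  have h2 (t : ℝ) : net.condLaplace w 0 t = 1 := by
    simp [Network.condLaplace, Network.powerLaplace]
  simp only [h1, h2, eneg_zero, mul_one, Pi.mul_apply] at h0
  rw [h0, h.lintegral_servedLOS_weighted w hf hc]

end IsModel

/-! ### Coefficients depending on the serving distance -/

lemma tendsto_eapprox_mul {f : ℝ → ℝ≥0∞} (hf : Measurable f) (t : ℝ) (a : ℝ≥0∞) :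
    Filter.Tendsto (fun n => SimpleFunc.eapprox f n t * a) Filter.atTop (nhds (f t * a)) := by
  rw [← SimpleFunc.iSup_eapprox_apply hf t, ENNReal.iSup_mul]
  exact tendsto_atTop_iSup fun m n hmn => mul_le_mul_left (SimpleFunc.monotone_eapprox f hmn t) a

namespace Network

variable {W : Type*} (net : Network W)

lemma powerLaplace_antitone (i : W × Sight) (r : ℝ) :
    Antitone fun c => net.powerLaplace i c r := fun _ _ h =>
  lintegral_mono fun m => eneg_antitone (mul_le_mul_left h (net.power i r m))

lemma tendsto_powerLaplace_eapprox (i : W × Sight) {c : ℝ → ℝ≥0∞} (hc : Measurable c) (t r : ℝ) :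
    Filter.Tendsto (fun n => net.powerLaplace i (SimpleFunc.eapprox c n t) r) Filter.atTop
      (nhds (net.powerLaplace i (c t) r)) := by
  have hp : Measurable fun m => net.power i r m :=
    (net.measurable_power i).comp (measurable_const.prodMk measurable_id)
  refine tendsto_lintegral_of_dominated_convergence (fun _ => 1)
    (fun n => measurable_eneg.comp (measurable_const.mul hp))
    (fun n => Filter.Eventually.of_forall fun m => eneg_le_one _) (by simp)
    (Filter.Eventually.of_forall fun m => ?_)
  exact (continuous_eneg.tendsto _).comp (tendsto_eapprox_mul hc t _)

lemma tendsto_condLaplace_eapprox [Fintype W] (w : W) {c : ℝ → W × Sight → ℝ≥0∞}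
    (hc : ∀ i, Measurable fun t => c t i) (t : ℝ) :
    Filter.Tendsto (fun n => net.condLaplace w (fun i => SimpleFunc.eapprox (fun t => c t i) n t) t)
      Filter.atTop (nhds (net.condLaplace w (c t) t)) := by
  unfold condLaplace
  simp_rw [← eneg_sum]
  refine (continuous_eneg.tendsto _).comp (tendsto_finsetSum _ fun i _ => ?_)
  refine lintegral_tendsto_of_tendsto_of_monotone
    (fun n => (measurable_const.sub (net.measurable_powerLaplace i _)).aemeasurable)
    (Filter.Eventually.of_forall fun r m n hmn => tsub_le_tsub_left
      (net.powerLaplace_antitone i r (SimpleFunc.monotone_eapprox _ hmn t)) 1)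
    (Filter.Eventually.of_forall fun r => ?_)
  exact ENNReal.Tendsto.sub tendsto_const_nhds (net.tendsto_powerLaplace_eapprox i (hc i) t r)
    (Or.inl ENNReal.one_ne_top)

lemma condLaplace_le_one [Fintype W] (w : W) (c : W × Sight → ℝ≥0∞) (t : ℝ) :
    net.condLaplace w c t ≤ 1 := by
  unfold condLaplace
  rw [← eneg_sum]
  exact eneg_le_one _

end Network

namespace IsModel

variable {W Ω : Type*} [Fintype W] [MeasurableSpace Ω] {μ : Measure Ω} {net : Network W} {F : Field W Ω}

lemma measurable_weighted (h : IsModel μ net F) (w : W) {c : ℝ → W × Sight → ℝ≥0∞}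
    (hc : ∀ i, Measurable fun t => c t i) :
    Measurable fun ω => F.weighted net w (c (F.servingDist net w ω)) ω :=
  Finset.measurable_sum _ fun i _ =>
    ((hc i).comp (Field.measurable_servingDist h.measurable_config w)).mul
      (h.measurable_classPower w i)

variable [IsProbabilityMeasure μ]

/-- On each level set of `c` the coefficients are constant, and the indicator of that set is a
function of the serving distance that can be merged into `f`. -/
lemma lintegral_weighted_eq_of_countable (h : IsModel μ net F) (w : W) {f : ℝ → ℝ≥0∞}
    (hf : Measurable f) {c : ℝ → W × Sight → ℝ≥0∞} (hc : ∀ i, Measurable fun t => c t i)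
    (hfin : ∀ t i, c t i ≠ ∞) (hcount : (range c).Countable) :
    ∫⁻ ω in F.servedLOS net w, f (F.servingDist net w ω) *
        eneg (F.weighted net w (c (F.servingDist net w ω)) ω) ∂μ
      = ∫⁻ ω in F.servedLOS net w, f (F.servingDist net w ω) *
          net.condLaplace w (c (F.servingDist net w ω)) (F.servingDist net w ω) ∂μ := by
  have := hcount.to_subtype
  have hx := Field.measurable_servingDist (net := net) h.measurable_config w
  have hcm : Measurable c := measurable_pi_lambda _ hc
  have hsplit (t : ℝ) (G : (W × Sight → ℝ≥0∞) → ℝ≥0∞) :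
      f t * G (c t) = ∑' v : range c, (c ⁻¹' {v.1}).indicator f t * G v := by
    rw [tsum_eq_single ⟨c t, mem_range_self t⟩]
    · rw [indicator_of_mem (by exact rfl)]
    · intro v hv
      rw [indicator_of_notMem, zero_mul]
      intro ht
      exact hv (Subtype.ext ht.symm)
  have hfv (v : range c) : Measurable ((c ⁻¹' {v.1}).indicator f) :=
    hf.indicator (hcm (measurableSet_singleton _))
  have h1 (ω : Ω) := hsplit (F.servingDist net w ω) fun v => eneg (F.weighted net w v ω)
  have h2 (ω : Ω) := hsplit (F.servingDist net w ω) fun v =>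
    net.condLaplace w v (F.servingDist net w ω)
  simp_rw [h1, h2]
  rw [lintegral_tsum, lintegral_tsum]
  · refine tsum_congr fun v => ?_
    refine h.lintegral_weighted_eq_condLaplace w (hfv v) fun i => ?_
    obtain ⟨t, ht⟩ := v.2
    rw [← ht]
    exact hfin t i
  · intro v
    have hL : Measurable (net.condLaplace w v) := net.measurable_condLaplace w measurable_const
    exact (((hfv v).comp hx).mul (hL.comp hx)).aemeasurable
  · intro v
    exact (((hfv v).comp hx).mul (measurable_eneg.comp
      (h.measurable_weighted w (c := fun _ => v) fun i => measurable_const))).aemeasurable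

lemma lintegral_weighted_eq (h : IsModel μ net F) (w : W) {f : ℝ → ℝ≥0∞}
    (hf : Measurable f) (hf1 : ∀ t, f t ≤ 1) {c : ℝ → W × Sight → ℝ≥0∞}
    (hc : ∀ i, Measurable fun t => c t i) :
    ∫⁻ ω in F.servedLOS net w, f (F.servingDist net w ω) *
        eneg (F.weighted net w (c (F.servingDist net w ω)) ω) ∂μ
      = ∫⁻ ω in F.servedLOS net w, f (F.servingDist net w ω) *
          net.condLaplace w (c (F.servingDist net w ω)) (F.servingDist net w ω) ∂μ := by
  have hx := Field.measurable_servingDist (net := net) h.measurable_config w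
  -- Each approximation takes finitely many values, all finite, so the countable case applies even
  -- where `c` is infinite.
  set C : ℕ → ℝ → W × Sight → ℝ≥0∞ := fun n t i => SimpleFunc.eapprox (fun t => c t i) n t with hC
  have hCm (n : ℕ) (i : W × Sight) : Measurable fun t => C n t i := SimpleFunc.measurable _
  have hcount (n : ℕ) : (range (C n)).Countable := by
    refine (Set.Countable.mono ?_ (Set.countable_univ_pi fun i : W × Sight =>
      (SimpleFunc.finite_range (SimpleFunc.eapprox (fun t => c t i) n)).countable))
    rintro _ ⟨t, rfl⟩ i _
    exact mem_range_self t
  have heq (n : ℕ) := h.lintegral_weighted_eq_of_countable w hf (hCm n)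
    (fun t i => (SimpleFunc.eapprox_lt_top _ n t).ne) (hcount n)
  have hfx (ω : Ω) : f (F.servingDist net w ω) ≠ ∞ :=
    ne_top_of_le_ne_top ENNReal.one_ne_top (hf1 _)
  have hfin : ∫⁻ _, 1 ∂(μ.restrict (F.servedLOS net w)) ≠ ∞ := by simp
  have h1 : Filter.Tendsto (fun n => ∫⁻ ω in F.servedLOS net w, f (F.servingDist net w ω) *
        eneg (F.weighted net w (C n (F.servingDist net w ω)) ω) ∂μ) Filter.atTop
      (nhds (∫⁻ ω in F.servedLOS net w, f (F.servingDist net w ω) *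
        eneg (F.weighted net w (c (F.servingDist net w ω)) ω) ∂μ)) := by
    refine tendsto_lintegral_of_dominated_convergence (fun _ => 1)
      (fun n => (hf.comp hx).mul (measurable_eneg.comp (h.measurable_weighted w (hCm n))))
      (fun n => Filter.Eventually.of_forall fun ω => mul_le_one' (hf1 _) (eneg_le_one _)) hfin
      (Filter.Eventually.of_forall fun ω => ?_)
    refine ENNReal.Tendsto.const_mul ((continuous_eneg.tendsto _).comp ?_) (Or.inr (hfx ω))
    exact tendsto_finsetSum _ fun i _ => tendsto_eapprox_mul (hc i) _ _
  have h2 : Filter.Tendsto (fun n => ∫⁻ ω in F.servedLOS net w, f (F.servingDist net w ω) *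
        net.condLaplace w (C n (F.servingDist net w ω)) (F.servingDist net w ω) ∂μ) Filter.atTop
      (nhds (∫⁻ ω in F.servedLOS net w, f (F.servingDist net w ω) *
        net.condLaplace w (c (F.servingDist net w ω)) (F.servingDist net w ω) ∂μ)) := by
    refine tendsto_lintegral_of_dominated_convergence (fun _ => 1)
      (fun n => (hf.comp hx).mul ((net.measurable_condLaplace w
        (measurable_pi_lambda _ (hCm n))).comp hx))
      (fun n => Filter.Eventually.of_forall fun ω =>
        mul_le_one' (hf1 _) (net.condLaplace_le_one w _ _)) hfin
      (Filter.Eventually.of_forall fun ω => ?_)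
    exact ENNReal.Tendsto.const_mul (net.tendsto_condLaplace_eapprox w hc _) (Or.inr (hfx ω))
  simp_rw [heq] at h1
  exact tendsto_nhds_unique h1 h2

end IsModel

/-! ### The analytic expression -/

/-- Exponential tilting by `e^{-θ x}` turns the density of `Γ(K, 1)` into `(1 + θ)^{-K}` times that
of rate `1 + θ`. -/
lemma lintegral_gammaMeasure_eneg {K : ℕ} (hK : 0 < K) {θ : ℝ} (hθ : 0 ≤ θ) :
    ∫⁻ x, eneg (ENNReal.ofReal (θ * x)) ∂(gammaMeasure (K : ℝ) 1)
      = ENNReal.ofReal (1 / (1 + θ) ^ K) := by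
  have hpdf (r : ℝ) : Measurable (gammaPDF (K : ℝ) r) :=
    (measurable_gammaPDFReal _ _).ennreal_ofReal
  have hK' : (0 : ℝ) < K := by exact_mod_cast hK
  rw [gammaMeasure, lintegral_withDensity_eq_lintegral_mul
    (g := fun x => eneg (ENNReal.ofReal (θ * x))) _ (hpdf 1) (measurable_eneg.comp (by fun_prop))]
  have h1 (x : ℝ) : (gammaPDF (K : ℝ) 1 * fun x => eneg (ENNReal.ofReal (θ * x))) x
      = ENNReal.ofReal (1 / (1 + θ) ^ K) * gammaPDF (K : ℝ) (1 + θ) x := by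
    simp only [Pi.mul_apply]
    rcases lt_or_ge x 0 with hx | hx
    · rw [gammaPDF_of_neg hx, gammaPDF_of_neg hx]; simp
    · have hΓ := Real.Gamma_pos_of_pos hK'
      rw [gammaPDF_of_nonneg hx, gammaPDF_of_nonneg hx, eneg_ofReal (by positivity),
        ← ENNReal.ofReal_mul (by positivity), ← ENNReal.ofReal_mul (by positivity)]
      congr 1
      rw [Real.one_rpow, Real.rpow_natCast, show -((1 + θ) * x) = -(1 * x) + -(θ * x) by ring,
        Real.exp_add]
      field_simp
  simp_rw [h1]
  rw [lintegral_const_mul _ (hpdf _), lintegral_gammaPDF_eq_one hK' (by linarith), mul_one]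

namespace Network

variable {W : Type*} (net : Network W)

lemma pathGain_div (j : W) (z : Sight) {r y : ℝ} (hr : 0 ≤ r) (hy : 0 < y) :
    net.pathGain j z (r / y) = y ^ net.α j z * net.pathGain j z r := by
  rw [pathGain, pathGain, Real.div_rpow hr hy.le, Real.rpow_neg hy.le, div_inv_eq_mul]
  ring

/-- The coefficient of the power received from the interferers of class `i`. -/
def coeff (w : W) (s y : ℝ) (i : W × Sight) : ℝ≥0∞ :=
  ENNReal.ofReal (s / (net.Mr w * net.Mt w)) * ENNReal.ofReal (y ^ net.α i.1 i.2)

/-- The base of the power in `kernel`, minus one. -/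
def theta (w : W) (i : W × Sight) (k : Fin 4) (s y t : ℝ) : ℝ :=
  net.fbar w i.1 k * net.C i.1 i.2 * s / net.K i.1 * (t / y) ^ (-net.α i.1 i.2)

lemma kernel_eq (w : W) (i : W × Sight) (k : Fin 4) (s y t : ℝ) :
    net.kernel w i.1 i.2 k s y t = 1 - 1 / (1 + net.theta w i k s y t) ^ net.K i.1 := rfl

lemma theta_nonneg (w : W) (i : W × Sight) (k : Fin 4) {s y t : ℝ} (hs : 0 ≤ s) (hy : 0 < y)
    (ht : 0 ≤ t) : 0 ≤ net.theta w i k s y t := by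
  have h1 := net.a_nonneg i.1 k
  have h2 := net.Mr_pos w
  have h3 := net.Mt_pos w
  have h4 := net.C_pos i.1 i.2
  unfold theta fbar
  positivity

lemma kernel_nonneg (w : W) (i : W × Sight) (k : Fin 4) {s y t : ℝ} (hs : 0 ≤ s) (hy : 0 < y)
    (ht : 0 ≤ t) : 0 ≤ net.kernel w i.1 i.2 k s y t := by
  have h1 := net.theta_nonneg w i k hs hy ht
  rw [kernel_eq, sub_nonneg, div_le_one (by positivity)]
  exact one_le_pow₀ (by linarith)

lemma measurable_kernel (w : W) (i : W × Sight) (k : Fin 4) (s y : ℝ) :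
    Measurable (net.kernel w i.1 i.2 k s y) := by
  unfold kernel
  fun_prop

/-- For each of the four gains, the exponent is `theta` times the fading power, and the Gamma
transform applies. -/
lemma powerLaplace_coeff (w : W) (i : W × Sight) {s y t : ℝ} (hs : 0 ≤ s) (hy : 0 < y)
    (ht : 0 ≤ t) :
    net.powerLaplace i (net.coeff w s y i) t
      = ∑ k, ENNReal.ofReal (net.b i.1 k * (1 / (1 + net.theta w i k s y t) ^ net.K i.1)) := by
  have hM1 := net.Mr_pos w
  have hM2 := net.Mt_pos w
  have hK := net.K_pos i.1
  have hm : Measurable fun m => eneg (net.coeff w s y i * net.power i t m) := by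
    have hpw : Measurable fun m => net.power i t m :=
      (net.measurable_power i).comp (measurable_const.prodMk measurable_id)
    exact measurable_eneg.comp (hpw.const_mul _)
  have hpt (k : Fin 4) (g : ℝ) : net.coeff w s y i * net.power i t (net.a i.1 k, g)
      = ENNReal.ofReal (net.theta w i k s y t * g) := by
    rw [coeff, power, ← ENNReal.ofReal_mul (by positivity), ← ENNReal.ofReal_mul (by positivity)]
    congr 1
    have h1 := net.pathGain_div i.1 i.2 ht hy
    rw [pathGain] at h1
    rw [theta, fbar]
    calc _ = s / (net.Mr w * net.Mt w) * net.a i.1 k * (g / net.K i.1) *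
          (y ^ net.α i.1 i.2 * net.pathGain i.1 i.2 t) := by ring
      _ = _ := by
        rw [← h1]
        field_simp
  rw [powerLaplace, markLaw, lintegral_prod _ hm.aemeasurable, gainLaw, lintegral_finsetSum_measure]
  refine Finset.sum_congr rfl fun k _ => ?_
  rw [lintegral_smul_measure, lintegral_dirac' _ hm.lintegral_prod_right']
  simp_rw [hpt]
  rw [lintegral_gammaMeasure_eneg hK (net.theta_nonneg w i k hs hy ht), smul_eq_mul,
    ← ENNReal.ofReal_mul (net.b_nonneg i.1 k)]

lemma one_sub_powerLaplace_coeff (w : W) (i : W × Sight) {s y t : ℝ} (hs : 0 ≤ s) (hy : 0 < y)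
    (ht : 0 ≤ t) :
    1 - net.powerLaplace i (net.coeff w s y i) t
      = ∑ k, ENNReal.ofReal (net.b i.1 k * net.kernel w i.1 i.2 k s y t) := by
  have hb := net.b_nonneg i.1
  have hθ (k : Fin 4) := net.theta_nonneg w i k hs hy ht
  have h1 (k : Fin 4) : 0 ≤ net.b i.1 k * (1 / (1 + net.theta w i k s y t) ^ net.K i.1) := by
    have := hθ k
    have := hb k
    positivity
  rw [net.powerLaplace_coeff w i hs hy ht, ← ENNReal.ofReal_sum_of_nonneg fun k _ => h1 k,
    ← ENNReal.ofReal_sum_of_nonneg fun k _ => mul_nonneg (hb k) (net.kernel_nonneg w i k hs hy ht),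
    ← ENNReal.ofReal_one, ← ENNReal.ofReal_sub _ (Finset.sum_nonneg fun k _ => h1 k)]
  congr 1
  -- The constant `1` is distributed over the four gains by their probabilities.
  nth_rewrite 1 [← net.sum_b i.1]
  rw [← Finset.sum_sub_distrib]
  refine Finset.sum_congr rfl fun k _ => ?_
  rw [kernel_eq]
  ring

lemma lintegral_one_sub_powerLaplace (w : W) (i : W × Sight) {s y ρ : ℝ} (hs : 0 ≤ s) (hy : 0 < y)
    (hρ : 0 ≤ ρ) :
    ∫⁻ r in Ioi ρ, (1 - net.powerLaplace i (net.coeff w s y i) r) ∂(net.radial i.1 i.2)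
      = ∑ k, ENNReal.ofReal (2 * Real.pi * net.lam i.1 * net.b i.1 k) *
          ∫⁻ t in Ioi ρ, ENNReal.ofReal (net.kernel w i.1 i.2 k s y t
            * net.linkProb i.1 i.2 t * t) := by
  have hp := net.measurable_linkProb i.1 i.2
  have hk := fun k => net.measurable_kernel w i k s y
  have hlam := net.lam_nonneg i.1
  have hpi := Real.pi_pos
  have hpl := net.measurable_powerLaplace i (net.coeff w s y i)
  have hkm (k : Fin 4) : Measurable fun t =>
      ENNReal.ofReal (net.kernel w i.1 i.2 k s y t * net.linkProb i.1 i.2 t * t) := by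
    have := hk k
    fun_prop
  rw [radial_eq, restrict_withDensity measurableSet_Ioi, Measure.restrict_restrict measurableSet_Ioi,
    inter_eq_left.2 (Ioi_subset_Ioi hρ), lintegral_withDensity_eq_lintegral_mul
      (g := fun r => 1 - net.powerLaplace i (net.coeff w s y i) r) _ (by fun_prop)
      (measurable_const.sub hpl)]
  simp_rw [← lintegral_const_mul _ (hkm _)]
  rw [← lintegral_finsetSum _ fun k _ => (hkm k).const_mul _]
  refine setLIntegral_congr_fun measurableSet_Ioi fun t ht => ?_
  have ht0 : 0 ≤ t := hρ.trans (le_of_lt ht)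
  have hp0 := net.linkProb_nonneg i.1 i.2 t
  simp only [Pi.mul_apply]
  rw [net.one_sub_powerLaplace_coeff w i hs hy ht0, Finset.mul_sum]
  refine Finset.sum_congr rfl fun k _ => ?_
  have hb := net.b_nonneg i.1 k
  rw [← ENNReal.ofReal_mul (by positivity), ← ENNReal.ofReal_mul (by positivity)]
  congr 1
  ring

lemma condLaplace_coeff [Fintype W] (w : W) {s y x : ℝ} (hs : 0 ≤ s) (hy : 0 < y) (hx : 0 ≤ x) :
    net.condLaplace w (net.coeff w s y) x = ENNReal.ofReal (net.laplaceFormula w s y x) := by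
  have hform : ENNReal.ofReal (net.laplaceFormula w s y x)
      = ∏ j, ∏ k, eneg (ENNReal.ofReal (2 * Real.pi * net.lam j * net.b j k)
        * (net.V w j k s y x + net.Wint w j k s y x)) := by
    rw [laplaceFormula, ENNReal.ofReal_prod_of_nonneg fun j _ =>
      Finset.prod_nonneg fun k _ => expNeg_nonneg _]
    refine Finset.prod_congr rfl fun j _ => ?_
    rw [ENNReal.ofReal_prod_of_nonneg fun k _ => expNeg_nonneg _]
    exact Finset.prod_congr rfl fun k _ => ofReal_expNeg _
  rw [hform, condLaplace, Fintype.prod_prod_type]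
  refine Finset.prod_congr rfl fun j _ => ?_
  have hz (g : Sight → ℝ≥0∞) : ∏ z, g z = g Sight.los * g Sight.nlos := by
    rw [show (Finset.univ : Finset Sight)
      = Finset.cons Sight.los (Finset.cons Sight.nlos ∅ (by simp)) (by simp) from rfl]
    simp
  rw [hz, ← eneg_add, ← eneg_sum,
    net.lintegral_one_sub_powerLaplace w (j, Sight.los) hs hy (net.radius_nonneg w _ hx),
    net.lintegral_one_sub_powerLaplace w (j, Sight.nlos) hs hy (net.radius_nonneg w _ hx),
    ← Finset.sum_add_distrib]
  congr 1
  refine Finset.sum_congr rfl fun k _ => ?_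
  rw [← mul_add, V, Wint, net.ψ_losRadius_eq w j hx]
  rfl

end Network

namespace Field

variable {W Ω : Type*} [Fintype W] {net : Network W} {F : Field W Ω}

/-- Measuring distances in units of `y` multiplies the path gain of a class by `y^α`. The exponent
depends on the class, hence the class-dependent weights. -/
lemma interference_eq_weighted (w : W) {s y : ℝ} (hs : 0 ≤ s) (hy : 0 < y) (ω : Ω) :
    ENNReal.ofReal (s / (net.Mr w * net.Mt w)) * F.interference net w y ω
      = F.weighted net w (net.coeff w s y) ω := by
  classical
  rw [weighted_eq_tsum, interference, ← ENNReal.tsum_mul_left]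
  refine tsum_congr fun q => ?_
  by_cases hq : F.Present q ω ∧ q ≠ F.servingBS net w ω
  · have hM1 := net.Mr_pos w
    have hM2 := net.Mt_pos w
    rw [if_pos hq, if_pos hq, net.pathGain_div _ _ (show 0 ≤ F.dist q ω from norm_nonneg _) hy, Network.coeff,
      Network.power, mul_assoc, ← ENNReal.ofReal_mul (by positivity),
      ← ENNReal.ofReal_mul (by positivity), ← ENNReal.ofReal_mul (by positivity)]
    congr 1
    simp only [mark]
    ring
  · rw [if_neg hq, if_neg hq, mul_zero]

end Field

namespace Network

variable {W : Type*} (net : Network W)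

lemma laplaceFormula_nonneg [Fintype W] (w : W) (s y x : ℝ) : 0 ≤ net.laplaceFormula w s y x :=
  Finset.prod_nonneg fun _ _ => Finset.prod_nonneg fun _ _ => expNeg_nonneg _

lemma measurable_coeff (w : W) {s y : ℝ → ℝ} (hs : Measurable s) (hy : Measurable y)
    (i : W × Sight) : Measurable fun t => net.coeff w (s t) (y t) i := by
  unfold coeff
  fun_prop

end Network

/-! ### Passage to the conditional expectation -/

/-- The bound by `1` on a finite measure makes both functions integrable, so equality of the lower
integrals over the sets of `m` carries over to the Bochner integrals that characterise the
conditional expectation. -/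
lemma condExp_toReal_ae_eq {Ω : Type*} {m m₀ : MeasurableSpace Ω} (hm : m ≤ m₀) {μ : Measure Ω}
    [IsFiniteMeasure μ] {u v : Ω → ℝ≥0∞} (hu : Measurable[m₀] u) (hu1 : ∀ ω, u ω ≤ 1)
    (hv : Measurable[m] v) (hv1 : ∀ ω, v ω ≤ 1)
    (huv : ∀ A, MeasurableSet[m] A → ∫⁻ ω in A, u ω ∂μ = ∫⁻ ω in A, v ω ∂μ) :
    μ[fun ω => (u ω).toReal | m] =ᵐ[μ] fun ω => (v ω).toReal := by
  have hint {f : Ω → ℝ≥0∞} (hf : Measurable[m₀] f) (hf1 : ∀ ω, f ω ≤ 1) :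
      Integrable (fun ω => (f ω).toReal) μ :=
    integrable_toReal_of_lintegral_ne_top hf.aemeasurable
      (ne_top_of_le_ne_top (measure_ne_top μ univ)
        ((lintegral_mono hf1).trans_eq (by simp)))
  have hset {f : Ω → ℝ≥0∞} (hf : Measurable[m₀] f) (hf1 : ∀ ω, f ω ≤ 1) (A : Set Ω) :
      ∫ ω in A, (f ω).toReal ∂μ = (∫⁻ ω in A, f ω ∂μ).toReal :=
    integral_toReal hf.aemeasurable
      (Filter.Eventually.of_forall fun ω => (hf1 ω).trans_lt ENNReal.one_lt_top)
  refine (ae_eq_condExp_of_forall_setIntegral_eq hm (hint hu hu1)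
    (fun A _ _ => (hint (hv.mono hm le_rfl) hv1).integrableOn) (fun A hA _ => ?_)
    hv.ennreal_toReal.stronglyMeasurable.aestronglyMeasurable).symm
  rw [hset (hv.mono hm le_rfl) hv1, hset hu hu1, huv A hA]

end MmWave

open MmWave in
theorem proposition2 {W Ω : Type*} [Fintype W] [MeasurableSpace Ω]
    (μ : Measure Ω) [IsProbabilityMeasure μ]
    (net : MmWave.Network W) (F : MmWave.Field W Ω) (hF : MmWave.IsModel μ net F)
    (w : W)
    (s : ℝ → ℝ) (hs : Measurable s) (hs_nonneg : ∀ x, 0 < x → 0 ≤ s x)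
    (y : ℝ → ℝ) (hy : Measurable y) (hy_pos : ∀ x, 0 < x → 0 < y x) :
    ((μ[|F.servedLOS net w])[fun ω =>
        MmWave.expNeg
          (ENNReal.ofReal (s (F.servingDist net w ω) / (net.Mr w * net.Mt w))
            * F.interference net w (y (F.servingDist net w ω)) ω)
        | MeasurableSpace.comap (F.servingDist net w) inferInstance])
      =ᵐ[μ[|F.servedLOS net w]]
    fun ω => net.laplaceFormula w (s (F.servingDist net w ω)) (y (F.servingDist net w ω))
      (F.servingDist net w ω) := by
  have hX := Field.measurable_servingDist (net := net) hF.measurable_config w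
  have hS := Field.measurableSet_servedLOS (net := net) hF.measurable_config w
  have hc := net.measurable_coeff w hs hy
  -- The sign conditions on `s` and `y` hold only at positive distances, so both sides can be
  -- rewritten only almost everywhere.
  have hpos : ∀ᵐ ω ∂μ[|F.servedLOS net w], 0 < F.servingDist net w ω := by
    refine Measure.ae_smul_measure ?_ _
    rw [ae_restrict_iff' hS]
    filter_upwards [hF.ae_regular w] with ω hω hl
    obtain ⟨l, hl⟩ := hl
    rw [hl.servingDist_eq]
    exact hω.dist_pos _ hl.1
  have hu : (fun ω => expNeg
      (ENNReal.ofReal (s (F.servingDist net w ω) / (net.Mr w * net.Mt w))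
        * F.interference net w (y (F.servingDist net w ω)) ω))
      =ᵐ[μ[|F.servedLOS net w]] fun ω =>
        (eneg (F.weighted net w (net.coeff w (s (F.servingDist net w ω))
          (y (F.servingDist net w ω))) ω)).toReal := by
    filter_upwards [hpos] with ω hω
    rw [expNeg_eq_toReal, F.interference_eq_weighted w (hs_nonneg _ hω) (hy_pos _ hω)]
  have hv : (fun ω => (net.condLaplace w (net.coeff w (s (F.servingDist net w ω))
        (y (F.servingDist net w ω))) (F.servingDist net w ω)).toReal)
      =ᵐ[μ[|F.servedLOS net w]] fun ω =>
        net.laplaceFormula w (s (F.servingDist net w ω)) (y (F.servingDist net w ω))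
          (F.servingDist net w ω) := by
    filter_upwards [hpos] with ω hω
    rw [net.condLaplace_coeff w (hs_nonneg _ hω) (hy_pos _ hω) hω.le,
      ENNReal.toReal_ofReal (net.laplaceFormula_nonneg w _ _ _)]
  refine (condExp_congr_ae hu).trans (Filter.EventuallyEq.trans ?_ hv)
  have hL : Measurable fun t => net.condLaplace w (net.coeff w (s t) (y t)) t :=
    net.measurable_condLaplace w (measurable_pi_lambda _ hc)
  refine condExp_toReal_ae_eq hX.comap_le
    (measurable_eneg.comp (hF.measurable_weighted w hc)) (fun ω => eneg_le_one _)
    (hL.comp (comap_measurable _)) (fun ω => net.condLaplace_le_one w _ _) ?_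
  rintro _ ⟨B, hB, rfl⟩
  -- Sets of the conditioning σ-algebra are preimages of Borel sets `B` under the serving distance;
  -- their indicators are the test functions `f`.
  have key := hF.lintegral_weighted_eq w (f := B.indicator 1) (measurable_one.indicator hB)
    (fun t => indicator_le_self' (fun _ _ => zero_le) t) hc
  have hrw (G : Ω → ℝ≥0∞) : ∫⁻ ω in F.servingDist net w ⁻¹' B, G ω ∂μ[|F.servedLOS net w]
      = (μ (F.servedLOS net w))⁻¹ * ∫⁻ ω in F.servedLOS net w,
        B.indicator 1 (F.servingDist net w ω) * G ω ∂μ := by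
    rw [ProbabilityTheory.cond, Measure.restrict_smul, lintegral_smul_measure, smul_eq_mul,
      ← lintegral_indicator (hX hB)]
    congr 1
    refine lintegral_congr fun ω => ?_
    by_cases h : F.servingDist net w ω ∈ B
    · rw [indicator_of_mem (by exact h), indicator_of_mem h, Pi.one_apply, one_mul]
    · rw [indicator_of_notMem (by exact h), indicator_of_notMem h, zero_mul]
  rw [hrw, hrw]
  exact congrArg _ key

end
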